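/- For $f:\mathbb R\to\mathbb R$ let $$Hf(x)=\frac1\pi\,\mathrm{p.v.}\!\int_{\mathbb R}\frac{f(y)}{y-x}\,dy=\lim_{\varepsilon\to0^+}\frac1\pi\int_{\varepsilon<|y-x|<1/\varepsilon}\frac{f(y)}{y-x}\,dy$$ denote the Hilbert transform, where the limit exists. A *global $C^1$ solution* of $$\partial_t\theta+(H\theta)\,\partial_x\theta=0 \qquad (1)$$ is a continuous function $\theta:[0,\infty)\times\mathbb R\to\mathbb R$, continuously differentiable on $(0,\infty)\times\mathbb R$, such that $\theta(t,x)\to0$ as $|x|\to\infty$ uniformly for $t$ in bounded intervals $[0,T]$, and such that for every $t>0$ and $x\in\mathbb R$ the principal value $H\theta(t,\cdot)(x)$ exists and (1) holds at $(t,x)$. **Theorem 3.4.** Let $\theta_0:\mathbb R\to\mathbb R$ satisfy $\theta_0(x)\to0$ as $x\to\pm\infty$ and have a positive global maximum, i.e. there is $x_0\in\mathbb R$ with $\theta_0(x_0)>0$ and $\theta_0(x)\le\theta_0(x_0)$ for all $x\in\mathbb R$. Then there is no global $C^1$ solution $\theta$ of (1) with $\theta(0,x)=\theta_0(x)$ for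 all $x\in\mathbb R$: a $C^1$ solution with this initial datum cannot exist for all time. -/

import Mathlib

open Set Filter Topology MeasureTheory

/-- `HasHilbertTransformAt f x v`: the principal value
`(1/π) p.v. ∫ f(y) / (y - x) dy` exists and equals `v`. The principal value is taken
symmetrically about `x`, both at the singularity `y = x` and at infinity. -/
def HasHilbertTransformAt (f : ℝ → ℝ) (x v : ℝ) : Prop :=
  Tendsto (fun ε : ℝ => (1 / Real.pi) * ∫ y in {y : ℝ | ε < |y - x| ∧ |y - x| < ε⁻¹}, f y / (y - x))
    (𝓝[>] 0) (𝓝 v)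

/-- `θ t x` is a global-in-time `C¹` solution, vanishing at spatial infinity, of
`∂ₜ θ + (Hθ) ∂ₓ θ = 0` on `[0, ∞) × ℝ`. Only the values `θ t x` with `t ≥ 0` matter.
The initial datum `θ 0` is attained continuously, and `C¹` regularity is asked for `t > 0`. -/
structure IsGlobalC1Solution (θ : ℝ → ℝ → ℝ) : Prop where
  /-- `θ` is continuous up to the initial time. -/
  continuousOn : ContinuousOn (fun p : ℝ × ℝ => θ p.1 p.2) (Ici 0 ×ˢ univ)
  /-- `θ` is jointly continuously differentiable for positive times. -/
  contDiffOn : ContDiffOn ℝ 1 (fun p : ℝ × ℝ => θ p.1 p.2) (Ioi 0 ×ˢ univ)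
  /-- `θ(t, x) → 0` as `|x| → ∞`, uniformly for `t` in bounded time intervals. -/
  vanishing : ∀ T : ℝ, ∀ ε > 0, ∃ R : ℝ, ∀ t ∈ Icc 0 T, ∀ x : ℝ, R ≤ |x| → |θ t x| < ε
  /-- The Hilbert transform of `θ(t, ·)` exists at every point and the equation holds. -/
  equation : ∀ t > 0, ∀ x : ℝ, ∃ v : ℝ, HasHilbertTransformAt (θ t) x v ∧
    deriv (fun s => θ s x) t + v * deriv (fun y => θ t y) x = 0

/-! With this sign of $H$ the flow runs towards a maximum of $\theta$. Transport preserves the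
positive maximum $M$ of $\theta$, whereas Poisson-type averages of $\theta$ over a suitably
shrinking scale stay strictly below $M$. At a small enough scale this contradicts continuity.

Put $y=x+\varepsilon\tan a$. The Poisson kernel becomes the uniform measure $da$ on a half period,
and, up to an additive constant, $H$ becomes convolution with $\frac1\pi\cot$
(`exists_hilbert_angle_form`). Let $P(a)=\theta(t,x+\varepsilon\tan a)$. At a maximum in $x$ of the
average, stationarity removes the constant, and the drift contributes
$-\frac1{\pi\varepsilon}\int\cos^2a\,P'(a)\int(P(b)-P(a))\cot(b-a)\,db\,da$. Integrating by parts in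
$a$ and symmetrising turns the double integral into half the quadratic form with kernel
$\frac12(\cos^2a+\cos^2b)/\sin^2(b-a)+\cos^2a+\cos^2b-1$. Bessel's inequality bounds this form below
by $\frac14(\int P\cos2a)^2$ (`form_lower`). A second integration by parts identifies $-\int P\cos
2a$ with $L=\int\cos^2a\,P'\tan a$, which is exactly the pairing produced by changing the scale
$\varepsilon$ (`abs_dilation_pairing_add_le`).

The drift therefore gives a negative multiple of $L^2/\varepsilon$, which absorbs the dilation term
$\varepsilon'L/\varepsilon$ at a cost $O(\varepsilon'^2/\varepsilon)$
(`exists_hasDerivAt_cutAverage_le`). For $\varepsilon(t)=e_0(1-t/T)^2$ this cost is constant in time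
and integrates to $O(e_0/T)$, so for large $T$ it cannot close the gap present initially at scale
$e_0$ (`exists_initial_gap`). The spatial supremum does not drop (`exists_lt_of_lt_initial`), so
near time $T$ a small-scale average is close to $M$ times its mass (`cutAverage_ge_of_modulus`), a
contradiction.

No decay of $\partial_x\theta$ is available, so $\cos^2$ is replaced by a weight `cutWeight h`
vanishing where $\cos a\le h$, and $1/\sin^2$ is compared with $1/(\sin^2+\mu^2)$. The errors are
controlled by $h$ and by `kernelDeficit`, uniformly over profiles with a common bound. -/

/-! ### Integrals over a half period of the angular variable -/

/-- Lebesgue measure on one period `(-π/2, π/2]` of the angular variable `arctan x`. -/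
noncomputable abbrev angleMeasure : Measure ℝ :=
  volume.restrict (Ioc (-(Real.pi / 2)) (Real.pi / 2))

theorem integral_angleMeasure (f : ℝ → ℝ) :
    ∫ a, f a ∂angleMeasure = ∫ a in (-(Real.pi / 2))..(Real.pi / 2), f a := by
  rw [intervalIntegral.integral_of_le (by linarith [Real.pi_pos])]

/-- `f` is integrable with integral `v`. -/
def HasIntegralValue {α : Type*} [MeasurableSpace α] (ν : Measure α) (f : α → ℝ) (v : ℝ) : Prop :=
  Integrable f ν ∧ ∫ x, f x ∂ν = v

namespace HasIntegralValue
variable {α : Type*} [MeasurableSpace α] {ν : Measure α} {f g : α → ℝ} {u v : ℝ}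

theorem add (hf : HasIntegralValue ν f u) (hg : HasIntegralValue ν g v) :
    HasIntegralValue ν (fun x => f x + g x) (u + v) :=
  ⟨hf.1.add hg.1, by rw [integral_add hf.1 hg.1, hf.2, hg.2]⟩

theorem const_mul (hf : HasIntegralValue ν f u) (c : ℝ) :
    HasIntegralValue ν (fun x => c * f x) (c * u) :=
  ⟨hf.1.const_mul c, by rw [integral_const_mul, hf.2]⟩

theorem sub (hf : HasIntegralValue ν f u) (hg : HasIntegralValue ν g v) :
    HasIntegralValue ν (fun x => f x - g x) (u - v) :=
  ⟨hf.1.sub hg.1, by rw [integral_sub hf.1 hg.1, hf.2, hg.2]⟩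

theorem mono (hf : HasIntegralValue ν f u) (hg : HasIntegralValue ν g v) (h : ∀ x, f x ≤ g x) :
    u ≤ v := by
  rw [← hf.2, ← hg.2]; exact integral_mono hf.1 hg.1 h

theorem congr (hf : HasIntegralValue ν f u) (h : ∀ x, g x = f x) : HasIntegralValue ν g u := by
  rwa [show g = f from funext h]

end HasIntegralValue

theorem MeasureTheory.Integrable.hasIntegralValue {α : Type*} [MeasurableSpace α] {ν : Measure α}
    {f : α → ℝ} (hf : Integrable f ν) : HasIntegralValue ν f (∫ x, f x ∂ν) := ⟨hf, rfl⟩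

theorem Measurable.integrable_of_abs_le {α : Type*} [MeasurableSpace α] {ν : Measure α}
    [IsFiniteMeasure ν] {f : α → ℝ} (hf : Measurable f) (B : ℝ) (hB : ∀ x, |f x| ≤ B) :
    Integrable f ν :=
  Integrable.of_bound hf.aestronglyMeasurable B (Eventually.of_forall hB)

theorem integral_angleMeasure_one : ∫ _a, (1 : ℝ) ∂angleMeasure = Real.pi := by
  rw [integral_angleMeasure]; simp

theorem integral_angleMeasure_cos_sq : ∫ a, Real.cos a ^ 2 ∂angleMeasure = Real.pi / 2 := by
  rw [integral_angleMeasure, integral_cos_sq]; simp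

theorem integral_angleMeasure_sin_sq : ∫ a, Real.sin a ^ 2 ∂angleMeasure = Real.pi / 2 := by
  rw [integral_angleMeasure, integral_sin_sq]; simp

theorem integral_angleMeasure_sin_mul_cos :
    ∫ a, Real.sin a * Real.cos a ∂angleMeasure = 0 := by
  rw [integral_angleMeasure, integral_sin_mul_cos₁]; simp

/-- The deficit `∫ (1 - sin² τ)` of the regularised kernel `τ = 1 / (sin² + μ²)`. -/
noncomputable def kernelDeficit (μ : ℝ) : ℝ :=
  ∫ a, μ ^ 2 / (Real.sin a ^ 2 + μ ^ 2) ∂angleMeasure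

theorem integral_odd_eq_zero {f : ℝ → ℝ} (hf : ∀ x, f (-x) = -f x) (b : ℝ) :
    ∫ x in (-b)..b, f x = 0 := by
  have h := intervalIntegral.integral_comp_neg (a := -b) (b := b) f
  simp only [hf, neg_neg, intervalIntegral.integral_neg] at h
  linarith

theorem integral_angleMeasure_sub {f : ℝ → ℝ} (hf : Function.Periodic f Real.pi) (a : ℝ) :
    ∫ b, f (b - a) ∂angleMeasure = ∫ b, f b ∂angleMeasure := by
  rw [integral_angleMeasure, integral_angleMeasure, intervalIntegral.integral_comp_sub_right]
  have := hf.intervalIntegral_add_eq (-(Real.pi / 2) - a) (-(Real.pi / 2))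
  convert this using 2 <;> ring

/-! ### Coercivity of the regularised quadratic form -/

section form
variable {μ : ℝ}

theorem deficit_nonneg (s : ℝ) : 0 ≤ μ ^ 2 / (s ^ 2 + μ ^ 2) := by positivity

theorem deficit_le_one (s : ℝ) : μ ^ 2 / (s ^ 2 + μ ^ 2) ≤ 1 :=
  div_le_one_of_le₀ (by nlinarith [sq_nonneg s]) (by positivity)

theorem integral_deficit_sub (a : ℝ) :
    ∫ b, μ ^ 2 / (Real.sin (b - a) ^ 2 + μ ^ 2) ∂angleMeasure = kernelDeficit μ := by
  refine integral_angleMeasure_sub (f := fun b => μ ^ 2 / (Real.sin b ^ 2 + μ ^ 2)) ?_ a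
  intro x
  simp [Real.sin_add_pi]

theorem kernelDeficit_nonneg : 0 ≤ kernelDeficit μ :=
  integral_nonneg fun _ => deficit_nonneg _

theorem inv_reg_le (hμ : 0 < μ) (s : ℝ) : |1 / (s ^ 2 + μ ^ 2)| ≤ 1 / μ ^ 2 := by
  rw [abs_of_nonneg (by positivity)]
  exact one_div_le_one_div_of_le (by positivity) (by nlinarith [sq_nonneg s])

/-- With $d=b-a$ one has $\cos^2b-\cos^2a=-\sin d\,\sin(2a+d)$. The part odd in $d$ integrates to
zero, and the even part cancels the integral of $\cos^2a+\cos^2b-1$ except for the regularisation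
deficit. So the diagonal terms of the form cost nothing in the limit $\mu\to0$. -/
theorem integral_diagonal_coefficient (hμ : 0 < μ) (a : ℝ) :
    ∫ b, ((1 / 2) * (Real.cos b ^ 2 - Real.cos a ^ 2) * (1 / (Real.sin (b - a) ^ 2 + μ ^ 2))
      + Real.cos a ^ 2 + Real.cos b ^ 2 - 1) ∂angleMeasure
      = (1 / 2) * Real.cos (2 * a) * kernelDeficit μ := by
  have hμ2 : ∀ d : ℝ, Real.sin d ^ 2 + μ ^ 2 ≠ 0 := fun d => by positivity
  have hpt : ∀ b, (1 / 2) * (Real.cos b ^ 2 - Real.cos a ^ 2)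
        * (1 / (Real.sin (b - a) ^ 2 + μ ^ 2)) + Real.cos a ^ 2 + Real.cos b ^ 2 - 1
      = (fun d => -(1 / 2) * Real.sin (2 * a) *
          (Real.sin d * Real.cos d / (Real.sin d ^ 2 + μ ^ 2))) (b - a)
        + ((1 / 2) * Real.cos (2 * a)) * (μ ^ 2 / (Real.sin (b - a) ^ 2 + μ ^ 2))
        + (Real.cos b ^ 2 + (-(1 / 2) * Real.cos (2 * a) + Real.cos a ^ 2 - 1) * 1) := by
    intro b
    have h1 : Real.cos b ^ 2 - Real.cos a ^ 2
        = -(Real.sin (b - a) * (Real.sin (2 * a) * Real.cos (b - a)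
            + Real.cos (2 * a) * Real.sin (b - a))) := by
      rw [← Real.sin_add, show 2 * a + (b - a) = b + a by ring, Real.sin_sub, Real.sin_add]
      nlinarith [Real.sin_sq_add_cos_sq a, Real.sin_sq_add_cos_sq b]
    rw [h1]
    have := hμ2 (b - a)
    field_simp
    ring
  have i1 : HasIntegralValue angleMeasure (fun b => (fun d => -(1 / 2) * Real.sin (2 * a) *
      (Real.sin d * Real.cos d / (Real.sin d ^ 2 + μ ^ 2))) (b - a)) 0 := by
    refine ⟨Continuous.integrableOn_Ioc (continuous_const.mul
      (Continuous.div (by fun_prop) (by fun_prop) fun b => hμ2 _)), ?_⟩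
    rw [integral_angleMeasure_sub, integral_angleMeasure, integral_odd_eq_zero]
    · intro x; simp only [Real.sin_neg, Real.cos_neg]; ring
    · intro x; simp only [Real.sin_add_pi, Real.cos_add_pi]; ring
  have i2 : HasIntegralValue angleMeasure (fun b => μ ^ 2 / (Real.sin (b - a) ^ 2 + μ ^ 2))
      (kernelDeficit μ) :=
    ⟨Continuous.integrableOn_Ioc (Continuous.div (by fun_prop) (by fun_prop) fun b => hμ2 _),
      integral_deficit_sub a⟩
  have i3 : HasIntegralValue angleMeasure (fun b => Real.cos b ^ 2) (Real.pi / 2) :=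
    ⟨Continuous.integrableOn_Ioc (by fun_prop), integral_angleMeasure_cos_sq⟩
  have i4 : HasIntegralValue angleMeasure (fun _ => (1 : ℝ)) Real.pi :=
    ⟨integrable_const _, integral_angleMeasure_one⟩
  rw [(((i1.add (i2.const_mul _)).add (i3.add (i4.const_mul _))).congr hpt).2, Real.cos_two_mul]
  ring

/-- Bessel's inequality for `g cos` against `cos` and `sin` on a half period. -/
theorem bessel_cos_sin {g : ℝ → ℝ} (hg : Measurable g) {B : ℝ} (hB : ∀ x, |g x| ≤ B) :
    (2 / Real.pi) * ((∫ a, Real.cos a ^ 2 * g a ∂angleMeasure) ^ 2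
      + (∫ a, Real.cos a * Real.sin a * g a ∂angleMeasure) ^ 2)
      ≤ ∫ a, Real.cos a ^ 2 * g a ^ 2 ∂angleMeasure := by
  set A := ∫ a, Real.cos a ^ 2 * g a ∂angleMeasure with hA
  set D := ∫ a, Real.cos a * Real.sin a * g a ∂angleMeasure with hD
  have hpi := Real.pi_pos
  have hB0 : 0 ≤ B := (abs_nonneg _).trans (hB 0)
  have j1 : Integrable (fun a => Real.cos a ^ 2 * g a ^ 2) angleMeasure := by
    refine Measurable.integrable_of_abs_le (by fun_prop) (1 * B ^ 2) fun a => ?_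
    rw [abs_mul, abs_pow, abs_pow]
    gcongr
    · exact pow_le_one₀ (abs_nonneg _) (Real.abs_cos_le_one a)
    · exact hB a
  have j2 : Integrable (fun a => Real.cos a ^ 2 * g a) angleMeasure := by
    refine Measurable.integrable_of_abs_le (by fun_prop) (1 * B) fun a => ?_
    rw [abs_mul, abs_pow]
    gcongr
    · exact pow_le_one₀ (abs_nonneg _) (Real.abs_cos_le_one a)
    · exact hB a
  have j3 : Integrable (fun a => Real.cos a * Real.sin a * g a) angleMeasure := by
    refine Measurable.integrable_of_abs_le (by fun_prop) (1 * 1 * B) fun a => ?_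
    rw [abs_mul, abs_mul]
    gcongr
    · exact Real.abs_cos_le_one a
    · exact Real.abs_sin_le_one a
    · exact hB a
  have j4 : Integrable (fun a => Real.cos a ^ 2) angleMeasure :=
    Continuous.integrableOn_Ioc (by fun_prop)
  have j5 : Integrable (fun a => Real.sin a ^ 2) angleMeasure :=
    Continuous.integrableOn_Ioc (by fun_prop)
  have j6 : Integrable (fun a => Real.sin a * Real.cos a) angleMeasure :=
    Continuous.integrableOn_Ioc (by fun_prop)
  -- The residual of the orthogonal projection; the factor $2/\pi$ inverts
  -- $\int\cos^2=\int\sin^2=\pi/2$.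
  have hsq : 0 ≤ ∫ a, (Real.cos a * g a - (2 / Real.pi * A) * Real.cos a
      - (2 / Real.pi * D) * Real.sin a) ^ 2 ∂angleMeasure :=
    integral_nonneg fun _ => sq_nonneg _
  have hexp : ∫ a, (Real.cos a * g a - (2 / Real.pi * A) * Real.cos a
      - (2 / Real.pi * D) * Real.sin a) ^ 2 ∂angleMeasure
      = ∫ a, (((Real.cos a ^ 2 * g a ^ 2 + (-2 * (2 / Real.pi * A)) * (Real.cos a ^ 2 * g a))
        + (-2 * (2 / Real.pi * D)) * (Real.cos a * Real.sin a * g a))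
        + (((2 / Real.pi * A) ^ 2 * Real.cos a ^ 2 + (2 / Real.pi * D) ^ 2 * Real.sin a ^ 2)
        + (2 * (2 / Real.pi * A) * (2 / Real.pi * D)) * (Real.sin a * Real.cos a)))
          ∂angleMeasure := by
    congr 1; ext a; ring
  have k4 : HasIntegralValue angleMeasure (fun a => Real.cos a ^ 2) (Real.pi / 2) :=
    ⟨j4, integral_angleMeasure_cos_sq⟩
  have k5 : HasIntegralValue angleMeasure (fun a => Real.sin a ^ 2) (Real.pi / 2) :=
    ⟨j5, integral_angleMeasure_sin_sq⟩
  have k6 : HasIntegralValue angleMeasure (fun a => Real.sin a * Real.cos a) 0 :=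
    ⟨j6, integral_angleMeasure_sin_mul_cos⟩
  rw [hexp, (((j1.hasIntegralValue.add (j2.hasIntegralValue.const_mul _)).add
    (j3.hasIntegralValue.const_mul _)).add
    (((k4.const_mul _).add (k5.const_mul _)).add (k6.const_mul _))).2, ← hA, ← hD] at hsq
  have : (2 / Real.pi * A) ^ 2 * (Real.pi / 2) + (2 / Real.pi * D) ^ 2 * (Real.pi / 2)
      = 2 / Real.pi * (A ^ 2 + D ^ 2) := by field_simp
  have h3 : -2 * (2 / Real.pi * A) * A + -2 * (2 / Real.pi * D) * D
      = -2 * (2 / Real.pi * (A ^ 2 + D ^ 2)) := by ring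
  linarith

end form

namespace HasIntegralValue

theorem prod_mul {ν : Measure ℝ} [SFinite ν] {f g : ℝ → ℝ} {u v : ℝ}
    (hf : HasIntegralValue ν f u) (hg : HasIntegralValue ν g v) :
    HasIntegralValue (ν.prod ν) (fun z => f z.1 * g z.2) (u * v) :=
  ⟨hf.1.mul_prod hg.1, by rw [integral_prod_mul, hf.2, hg.2]⟩

theorem prod_swap {ν : Measure ℝ} [SFinite ν] {F : ℝ × ℝ → ℝ} {v : ℝ}
    (hF : HasIntegralValue (ν.prod ν) F v) :
    HasIntegralValue (ν.prod ν) (fun z => F z.swap) v :=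
  ⟨hF.1.swap, by rw [integral_prod_swap, hF.2]⟩

end HasIntegralValue

theorem abs_reg_quotient_le {μ : ℝ} (hμ : 0 < μ) {C x s : ℝ} (hC : 0 ≤ C) (hx : |x| ≤ C) :
    |x * (1 / (s ^ 2 + μ ^ 2))| ≤ C * (1 / μ ^ 2) := by
  rw [abs_mul]
  exact mul_le_mul hx (inv_reg_le hμ s) (abs_nonneg _) hC

theorem integral_deficit_prod {μ : ℝ} :
    HasIntegralValue (angleMeasure.prod angleMeasure)
      (fun z : ℝ × ℝ => μ ^ 2 / (Real.sin (z.2 - z.1) ^ 2 + μ ^ 2))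
      (Real.pi * kernelDeficit μ) := by
  have hi : Integrable (fun z : ℝ × ℝ => μ ^ 2 / (Real.sin (z.2 - z.1) ^ 2 + μ ^ 2))
      (angleMeasure.prod angleMeasure) := by
    refine Measurable.integrable_of_abs_le (by fun_prop) 1 fun z => ?_
    rw [abs_of_nonneg (deficit_nonneg _)]; exact deficit_le_one _
  refine ⟨hi, ?_⟩
  rw [integral_prod _ hi]
  simp_rw [integral_deficit_sub]
  rw [integral_const]; simp [Real.pi_pos.le]

theorem integrable_regularised_form {μ C : ℝ} (hμ : 0 < μ) {P : ℝ → ℝ} (hP : Measurable P)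
    (hC : ∀ x, |P x| ≤ C) :
    Integrable (fun z : ℝ × ℝ => (P z.1 - P z.2) ^ 2 *
      ((1 / 2) * (Real.cos z.1 ^ 2 + Real.cos z.2 ^ 2)
          * (1 / (Real.sin (z.2 - z.1) ^ 2 + μ ^ 2)) + Real.cos z.1 ^ 2 + Real.cos z.2 ^ 2 - 1))
      (angleMeasure.prod angleMeasure) := by
  have hc1 : ∀ x, Real.cos x ^ 2 ≤ 1 := Real.cos_sq_le_one
  have hc0 : ∀ x, 0 ≤ Real.cos x ^ 2 := fun x => sq_nonneg _
  refine Measurable.integrable_of_abs_le (by fun_prop)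
    ((2 * C) ^ 2 * (1 * (1 / μ ^ 2) + 1)) fun z => ?_
  rw [abs_mul, abs_of_nonneg (sq_nonneg (P z.1 - P z.2))]
  have h0 : (P z.1 - P z.2) ^ 2 ≤ (2 * C) ^ 2 := by
    have h1 := abs_le.1 (hC z.1); have h2 := abs_le.1 (hC z.2)
    exact sq_le_sq' (by linarith) (by linarith)
  refine mul_le_mul h0 ?_ (abs_nonneg _) (sq_nonneg _)
  have h1 : |(1 / 2) * (Real.cos z.1 ^ 2 + Real.cos z.2 ^ 2)
      * (1 / (Real.sin (z.2 - z.1) ^ 2 + μ ^ 2))| ≤ 1 * (1 / μ ^ 2) := by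
    refine abs_reg_quotient_le hμ zero_le_one ?_
    rw [abs_le]; constructor <;> linarith [hc1 z.1, hc1 z.2, hc0 z.1, hc0 z.2]
  have h2 : |Real.cos z.1 ^ 2 + Real.cos z.2 ^ 2 - 1| ≤ 1 := by
    rw [abs_le]; constructor <;> linarith [hc1 z.1, hc1 z.2, hc0 z.1, hc0 z.2]
  rw [add_assoc, add_sub_assoc]
  exact (abs_add_le _ _).trans (add_le_add h1 h2)

set_option maxHeartbeats 1000000 in
/-- Coercivity, up to the kernel deficit, of the regularised quadratic form, for functions of
mean zero. -/
theorem form_lower_mean_zero {μ : ℝ} (hμ : 0 < μ) (hμ1 : μ ≤ 1) {g : ℝ → ℝ} (hg : Measurable g)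
    {B : ℝ} (hB : ∀ x, |g x| ≤ B) (h0 : ∫ a, g a ∂angleMeasure = 0) :
    (1 / 4) * (∫ a, g a * Real.cos (2 * a) ∂angleMeasure) ^ 2
        - 2 * Real.pi * B ^ 2 * kernelDeficit μ
      ≤ ∫ z, (g z.1 - g z.2) ^ 2 * ((1 / 2) * (Real.cos z.1 ^ 2 + Real.cos z.2 ^ 2)
          * (1 / (Real.sin (z.2 - z.1) ^ 2 + μ ^ 2)) + Real.cos z.1 ^ 2 + Real.cos z.2 ^ 2 - 1)
          ∂(angleMeasure.prod angleMeasure) := by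
  have hpi := Real.pi_pos
  have hB0 : 0 ≤ B := (abs_nonneg _).trans (hB 0)
  have hc1 : ∀ x, Real.cos x ^ 2 ≤ 1 := Real.cos_sq_le_one
  have hc0 : ∀ x, 0 ≤ Real.cos x ^ 2 := fun x => sq_nonneg _
  have hg2 : ∀ x, g x ^ 2 ≤ B ^ 2 := fun x => sq_le_sq' (abs_le.1 (hB x)).1 (abs_le.1 (hB x)).2
  have bc : ∀ x, |Real.cos x| ≤ 1 := Real.abs_cos_le_one
  have bs : ∀ x, |Real.sin x| ≤ 1 := Real.abs_sin_le_one
  have j0 : Integrable g angleMeasure := hg.integrable_of_abs_le B hB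
  have j1 : Integrable (fun a => Real.cos a ^ 2 * g a ^ 2) angleMeasure := by
    refine Measurable.integrable_of_abs_le (by fun_prop) (1 * B ^ 2) fun a => ?_
    rw [abs_mul, abs_of_nonneg (hc0 a), abs_of_nonneg (sq_nonneg (g a))]
    exact mul_le_mul (hc1 a) (hg2 a) (sq_nonneg _) zero_le_one
  have j2 : Integrable (fun a => Real.cos a ^ 2 * g a) angleMeasure := by
    refine Measurable.integrable_of_abs_le (by fun_prop) (1 * B) fun a => ?_
    rw [abs_mul, abs_of_nonneg (hc0 a)]
    exact mul_le_mul (hc1 a) (hB a) (abs_nonneg _) zero_le_one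
  have j3 : Integrable (fun a => Real.cos a * Real.sin a * g a) angleMeasure := by
    refine Measurable.integrable_of_abs_le (by fun_prop) (1 * 1 * B) fun a => ?_
    rw [abs_mul, abs_mul]
    have := bc a; have := bs a; have := hB a
    gcongr
  have one : HasIntegralValue angleMeasure (fun _ => (1 : ℝ)) Real.pi :=
    ⟨integrable_const _, integral_angleMeasure_one⟩
  set Q := ∫ a, Real.cos a ^ 2 * g a ^ 2 ∂angleMeasure with hQ
  set A := ∫ a, Real.cos a ^ 2 * g a ∂angleMeasure with hA
  set D := ∫ a, Real.cos a * Real.sin a * g a ∂angleMeasure with hD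
  have i0 : HasIntegralValue angleMeasure g 0 := ⟨j0, h0⟩
  have i1 : HasIntegralValue angleMeasure _ Q := j1.hasIntegralValue
  have i2 : HasIntegralValue angleMeasure _ A := j2.hasIntegralValue
  have i3 : HasIntegralValue angleMeasure _ D := j3.hasIntegralValue
  have ha : ∫ a, g a * Real.cos (2 * a) ∂angleMeasure = 2 * A := by
    have := ((i2.const_mul 2).sub i0).congr (g := fun a => g a * Real.cos (2 * a))
      (fun a => by rw [Real.cos_two_mul]; ring)
    rw [this.2]; ring
  have hbes : (2 / Real.pi) * (A ^ 2 + D ^ 2) ≤ Q := bessel_cos_sin hg hB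
  -- the positive part of the form, with constant kernel
  have hE := ((((i1.prod_mul one).add (one.prod_mul i1)).sub ((i2.prod_mul i2).const_mul 2)).sub
    ((i3.prod_mul i3).const_mul 2))
  -- diagonal terms
  have hAmeas : Measurable fun z : ℝ × ℝ => g z.1 ^ 2 *
      ((1 / 2) * (Real.cos z.2 ^ 2 - Real.cos z.1 ^ 2)
        * (1 / (Real.sin (z.2 - z.1) ^ 2 + μ ^ 2)) + Real.cos z.1 ^ 2 + Real.cos z.2 ^ 2 - 1) := by
    fun_prop
  have hAint : Integrable (fun z : ℝ × ℝ => g z.1 ^ 2 *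
      ((1 / 2) * (Real.cos z.2 ^ 2 - Real.cos z.1 ^ 2)
        * (1 / (Real.sin (z.2 - z.1) ^ 2 + μ ^ 2)) + Real.cos z.1 ^ 2 + Real.cos z.2 ^ 2 - 1))
      (angleMeasure.prod angleMeasure) := by
    refine hAmeas.integrable_of_abs_le (B ^ 2 * (1 * (1 / μ ^ 2) + 1)) fun z => ?_
    rw [abs_mul, abs_of_nonneg (sq_nonneg (g z.1))]
    refine mul_le_mul (hg2 _) ?_ (abs_nonneg _) (sq_nonneg _)
    have h1 : |(1 / 2) * (Real.cos z.2 ^ 2 - Real.cos z.1 ^ 2)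
        * (1 / (Real.sin (z.2 - z.1) ^ 2 + μ ^ 2))| ≤ 1 * (1 / μ ^ 2) := by
      refine abs_reg_quotient_le hμ zero_le_one ?_
      rw [abs_le]; constructor <;> linarith [hc1 z.1, hc1 z.2, hc0 z.1, hc0 z.2]
    have h2 : |Real.cos z.1 ^ 2 + Real.cos z.2 ^ 2 - 1| ≤ 1 := by
      rw [abs_le]; constructor <;> linarith [hc1 z.1, hc1 z.2, hc0 z.1, hc0 z.2]
    rw [add_assoc, add_sub_assoc]
    exact (abs_add_le _ _).trans (add_le_add h1 h2)
  have hAval := hAint.hasIntegralValue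
  set U := ∫ z : ℝ × ℝ, g z.1 ^ 2 *
      ((1 / 2) * (Real.cos z.2 ^ 2 - Real.cos z.1 ^ 2)
        * (1 / (Real.sin (z.2 - z.1) ^ 2 + μ ^ 2)) + Real.cos z.1 ^ 2 + Real.cos z.2 ^ 2 - 1)
      ∂(angleMeasure.prod angleMeasure) with hU
  have he0 : 0 ≤ kernelDeficit μ := kernelDeficit_nonneg
  have hUle : -((1 / 2) * B ^ 2 * kernelDeficit μ * Real.pi) ≤ U := by
    rw [hU, integral_prod _ hAint]
    simp_rw [integral_const_mul, integral_diagonal_coefficient hμ]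
    have k1 : Integrable (fun x => g x ^ 2 * (1 / 2 * Real.cos (2 * x) * kernelDeficit μ))
        angleMeasure := by
      refine Measurable.integrable_of_abs_le (by fun_prop)
        (B ^ 2 * (1 / 2 * 1 * kernelDeficit μ)) fun a => ?_
      rw [abs_mul, abs_mul, abs_mul, abs_of_nonneg (sq_nonneg (g a)), abs_of_nonneg he0,
        abs_of_nonneg (by norm_num : (0:ℝ) ≤ 1 / 2)]
      have := bc (2 * a); have := hg2 a
      gcongr
    have := ((one.const_mul (-((1 / 2) * B ^ 2 * kernelDeficit μ)))).mono k1.hasIntegralValue ?_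
    · linarith
    · intro x
      have h1 : -1 ≤ Real.cos (2 * x) := Real.neg_one_le_cos _
      have h2 : 0 ≤ g x ^ 2 := sq_nonneg _
      have h3 : 0 ≤ g x ^ 2 * kernelDeficit μ := by positivity
      have h4 : g x ^ 2 * kernelDeficit μ ≤ B ^ 2 * kernelDeficit μ := by
        have := hg2 x
        gcongr
      nlinarith [mul_le_mul_of_nonneg_left h1 h3]
  -- the deficit term
  have hdef := integral_deficit_prod (μ := μ)
  -- Each remaining cross term has a factor $\int g=0$; this is where mean zero enters.
  have hT4 := ((i2.prod_mul i0).add (i0.prod_mul i2)).sub ((i0.prod_mul i0).const_mul (1 / 2))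
  have hfull := integrable_regularised_form hμ hg hB
  have hlow := ((((hE.const_mul (1 / 2)).add (hAval.add hAval.prod_swap)).sub
    (hdef.const_mul (B ^ 2))).sub (hT4.const_mul 2)).mono hfull.hasIntegralValue ?_
  · rw [ha]
    -- Half the integral of the positive part is $\pi Q-A^2-D^2$, which by Bessel is at least
    -- $A^2+D^2\ge A^2$. The diagonal and deficit errors each cost at most $\pi B^2$ times the
    -- deficit.
    have : A ^ 2 + D ^ 2 ≤ Real.pi / 2 * Q := by
      calc A ^ 2 + D ^ 2 = Real.pi / 2 * ((2 / Real.pi) * (A ^ 2 + D ^ 2)) := by field_simp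
        _ ≤ _ := by gcongr
    nlinarith [sq_nonneg D]
  · rintro ⟨x, y⟩
    simp only [Prod.swap_prod_mk]
    rw [show x - y = -(y - x) by ring, Real.sin_neg, neg_sq]
    set c := Real.cos x with hc
    set c' := Real.cos y with hc'
    set s := Real.sin x with hs
    set s' := Real.sin y with hs'
    have e1 : Real.sin (y - x) = s' * c - c' * s := by rw [Real.sin_sub]
    set d := Real.sin (y - x) with hd
    set t := 1 / (d ^ 2 + μ ^ 2) with ht
    have p1 : s ^ 2 + c ^ 2 = 1 := Real.sin_sq_add_cos_sq x
    have p2 : s' ^ 2 + c' ^ 2 = 1 := Real.sin_sq_add_cos_sq y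
    have hdm : 0 < d ^ 2 + μ ^ 2 := by positivity
    have htd : d ^ 2 * t = 1 - μ ^ 2 / (d ^ 2 + μ ^ 2) := by
      rw [ht]; field_simp; ring
    set f := μ ^ 2 / (d ^ 2 + μ ^ 2) with hf
    have hd1 : d ^ 2 ≤ 1 := Real.sin_sq_le_one _
    have htge : 1 / 2 ≤ t := by
      rw [ht]; exact one_div_le_one_div_of_le hdm (by nlinarith)
    -- Law of cosines for the vectors $c\,(c,s)$ and $c'(c',s')$. It trades the off-diagonal factor
    -- $c^2+c'^2$ for $d^2$, and $d^2t=1-f$.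
    have hdsq : d ^ 2 = c ^ 2 + c' ^ 2 - 2 * c * c' * (c * c' + s * s') := by
      rw [e1]
      linear_combination (c' ^ 2) * p1 + c ^ 2 * p2
    set G := g x
    set G' := g y
    -- This is the squared distance between $cG\,(c,s)$ and $c'G'(c',s')$.
    have hEnn : 0 ≤ c ^ 2 * G ^ 2 + c' ^ 2 * G' ^ 2 - 2 * (c ^ 2 * G * (c' ^ 2 * G'))
        - 2 * (c * s * G * (c' * s' * G')) := by
      have : c ^ 2 * G ^ 2 + c' ^ 2 * G' ^ 2 - 2 * (c ^ 2 * G * (c' ^ 2 * G'))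
        - 2 * (c * s * G * (c' * s' * G'))
        = (c * G * c - c' * G' * c') ^ 2 + (c * G * s - c' * G' * s') ^ 2 := by
        linear_combination -(c ^ 2 * G ^ 2) * p1 - (c' ^ 2 * G' ^ 2) * p2
      rw [this]; positivity
    have hcross : -(B ^ 2 * f) ≤ G * G' * f := by
      have h1 : |G * G'| ≤ B * B := by
        rw [abs_mul]; exact mul_le_mul (hB x) (hB y) (abs_nonneg _) hB0
      have hf0 : 0 ≤ f := deficit_nonneg _
      nlinarith [(abs_le.1 h1).1]
    -- Positive part times $t$, plus diagonal terms, plus deficit, plus products that integrate to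
    -- zero.
    have hmain : (G - G') ^ 2 * (1 / 2 * (c ^ 2 + c' ^ 2) * t + c ^ 2 + c' ^ 2 - 1)
        = (c ^ 2 * G ^ 2 + c' ^ 2 * G' ^ 2 - 2 * (c ^ 2 * G * (c' ^ 2 * G'))
          - 2 * (c * s * G * (c' * s' * G'))) * t
          + (G ^ 2 * (1 / 2 * (c' ^ 2 - c ^ 2) * t + c ^ 2 + c' ^ 2 - 1)
            + G' ^ 2 * (1 / 2 * (c ^ 2 - c' ^ 2) * t + c' ^ 2 + c ^ 2 - 1))
          + G * G' * f
          - 2 * (c ^ 2 * G * G' + G * (c' ^ 2 * G') - 1 / 2 * (G * G')) := by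
      have : f = 1 - d ^ 2 * t := by rw [htd]; ring
      rw [this, hdsq]; ring
    rw [hmain]
    have hEt := mul_le_mul_of_nonneg_left htge hEnn
    clear_value c c' s s' d t f G G'
    linarith

/-- Coercivity, up to the kernel deficit, of the regularised quadratic form. -/
theorem form_lower {μ : ℝ} (hμ : 0 < μ) (hμ1 : μ ≤ 1) {P : ℝ → ℝ} (hP : Measurable P)
    {C : ℝ} (hC : ∀ x, |P x| ≤ C) :
    (1 / 4) * (∫ a, P a * Real.cos (2 * a) ∂angleMeasure) ^ 2
        - 8 * Real.pi * C ^ 2 * kernelDeficit μ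
      ≤ ∫ z, (P z.1 - P z.2) ^ 2 * ((1 / 2) * (Real.cos z.1 ^ 2 + Real.cos z.2 ^ 2)
          * (1 / (Real.sin (z.2 - z.1) ^ 2 + μ ^ 2)) + Real.cos z.1 ^ 2 + Real.cos z.2 ^ 2 - 1)
          ∂(angleMeasure.prod angleMeasure) := by
  have hpi := Real.pi_pos
  have j := (hP.integrable_of_abs_le C hC : Integrable P angleMeasure).hasIntegralValue
  set I := ∫ a, P a ∂angleMeasure with hI
  have one : HasIntegralValue angleMeasure (fun _ => (1 : ℝ)) Real.pi :=
    ⟨integrable_const _, integral_angleMeasure_one⟩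
  have hIle : |I / Real.pi| ≤ C := by
    have h1 := j.mono (one.const_mul C) fun x => by simpa using (abs_le.1 (hC x)).2
    have h2 := (one.const_mul (-C)).mono j fun x => by simpa using (abs_le.1 (hC x)).1
    rw [abs_le, le_div_iff₀ hpi, div_le_iff₀ hpi]
    exact ⟨h2, h1⟩
  have h0 := (j.sub (one.const_mul (I / Real.pi)))
  have hcos : HasIntegralValue angleMeasure (fun a => Real.cos (2 * a)) 0 := by
    refine ⟨Continuous.integrableOn_Ioc (by fun_prop), ?_⟩
    have k : HasIntegralValue angleMeasure (fun a => Real.cos a ^ 2) (Real.pi / 2) :=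
      ⟨Continuous.integrableOn_Ioc (by fun_prop), integral_angleMeasure_cos_sq⟩
    rw [(((k.const_mul 2).sub one).congr fun a => Real.cos_two_mul a).2]; ring
  have hPc : Integrable (fun a => P a * Real.cos (2 * a)) angleMeasure := by
    refine Measurable.integrable_of_abs_le (by fun_prop) (C * 1) fun a => ?_
    rw [abs_mul]
    exact mul_le_mul (hC a) (Real.abs_cos_le_one _) (abs_nonneg _) ((abs_nonneg _).trans (hC a))
  -- The form sees only differences and $\cos 2a$ is orthogonal to constants, so the mean can be
  -- removed; this at most doubles the bound.
  have hmz := form_lower_mean_zero hμ hμ1 (g := fun a => P a - I / Real.pi * 1) (by fun_prop)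
    (B := 2 * C) (fun x => by
      have h1 := abs_le.1 (hC x); have h2 := abs_le.1 hIle
      rw [abs_le]; constructor <;> linarith) (by rw [h0.2]; field_simp; ring)
  have hc := ((hPc.hasIntegralValue.sub (hcos.const_mul (I / Real.pi))).congr
    (g := fun a => (P a - I / Real.pi * 1) * Real.cos (2 * a)) fun a => by ring).2
  have hd : ∀ z : ℝ × ℝ, (P z.1 - I / Real.pi * 1) - (P z.2 - I / Real.pi * 1) = P z.1 - P z.2 :=
    fun z => by ring
  simp_rw [hd] at hmz
  rw [hc] at hmz
  refine le_trans (le_of_eq ?_) hmz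
  ring

/-! ### The truncated weight and its kernel -/

theorem hasDerivAt_max_zero_sq (x : ℝ) :
    HasDerivAt (fun y : ℝ => max y 0 ^ 2) (2 * max x 0) x := by
  rcases lt_trichotomy x 0 with hx | rfl | hx
  · have h1 : (fun y : ℝ => max y 0 ^ 2) =ᶠ[𝓝 x] fun _ => 0 := by
      filter_upwards [gt_mem_nhds hx] with y hy
      rw [max_eq_right hy.le]; norm_num
    rw [max_eq_right hx.le, mul_zero]
    exact (hasDerivAt_const x (0 : ℝ)).congr_of_eventuallyEq h1
  · rw [hasDerivAt_iff_isLittleO]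
    simp only [max_self, mul_zero, smul_zero, sub_zero, ne_eq, OfNat.ofNat_ne_zero,
      not_false_eq_true, zero_pow]
    have h2 : (fun y : ℝ => max y 0 ^ 2) =O[𝓝 0] fun y : ℝ => y ^ 2 := by
      refine Asymptotics.IsBigO.of_bound 1 (Eventually.of_forall fun y => ?_)
      rw [Real.norm_eq_abs, Real.norm_eq_abs, one_mul, abs_of_nonneg (sq_nonneg _),
        abs_of_nonneg (sq_nonneg _)]
      rcases le_total y 0 with hy | hy
      · rw [max_eq_right hy]; simpa using sq_nonneg y
      · rw [max_eq_left hy]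
    refine h2.trans_isLittleO ?_
    simpa using Asymptotics.isLittleO_pow_id (𝕜 := ℝ) (n := 2) (by norm_num)
  · have h1 : (fun y : ℝ => max y 0 ^ 2) =ᶠ[𝓝 x] fun y => y ^ 2 := by
      filter_upwards [lt_mem_nhds hx] with y hy
      rw [max_eq_left (le_of_lt hy)]
    rw [max_eq_left hx.le]
    have := (hasDerivAt_pow 2 x).congr_of_eventuallyEq h1
    simpa using this

/-- A truncation of `cos²` that vanishes near `±π/2`. -/
noncomputable def cutWeight (h a : ℝ) : ℝ := max (Real.cos a - h) 0 ^ 2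

/-- The derivative of `cutWeight`. -/
noncomputable def cutWeightDeriv (h a : ℝ) : ℝ := -2 * Real.sin a * max (Real.cos a - h) 0

section cutWeight
variable {h : ℝ}

theorem hasDerivAt_cutWeight (a : ℝ) : HasDerivAt (cutWeight h) (cutWeightDeriv h a) a := by
  have : HasDerivAt (cutWeight h) (2 * max (Real.cos a - h) 0 * -Real.sin a) a :=
    HasDerivAt.comp (h₂ := fun y : ℝ => max y 0 ^ 2) (h := fun x => Real.cos x - h) a
      (hasDerivAt_max_zero_sq (Real.cos a - h)) ((Real.hasDerivAt_cos a).sub_const h)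
  exact this.congr_deriv (by unfold cutWeightDeriv; ring)

theorem measurable_cutWeight : Measurable (cutWeight h) := by unfold cutWeight; fun_prop

theorem measurable_cutWeightDeriv : Measurable (cutWeightDeriv h) := by
  unfold cutWeightDeriv; fun_prop

theorem cutWeight_of_cos_le {a : ℝ} (ha : Real.cos a ≤ h) : cutWeight h a = 0 := by
  rw [cutWeight, max_eq_right (by linarith)]; norm_num

theorem cutWeightDeriv_of_cos_le {a : ℝ} (ha : Real.cos a ≤ h) : cutWeightDeriv h a = 0 := by
  rw [cutWeightDeriv, max_eq_right (by linarith)]; norm_num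

theorem cutWeight_nonneg (a : ℝ) : 0 ≤ cutWeight h a := sq_nonneg _

theorem max_cos_sub_le (hh : 0 ≤ h) {a : ℝ} (ha : 0 ≤ Real.cos a) :
    max (Real.cos a - h) 0 ≤ Real.cos a := max_le (by linarith) ha

theorem cutWeight_le_cos_sq (hh : 0 ≤ h) {a : ℝ} (ha : 0 ≤ Real.cos a) :
    cutWeight h a ≤ Real.cos a ^ 2 :=
  pow_le_pow_left₀ (le_max_right _ _) (max_cos_sub_le hh ha) 2

theorem cutWeight_le_one (hh : 0 ≤ h) (a : ℝ) : cutWeight h a ≤ 1 :=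
  pow_le_one₀ (le_max_right _ _) (max_le (by linarith [Real.cos_le_one a]) zero_le_one)

theorem abs_cutWeightDeriv_le (hh : 0 ≤ h) (a : ℝ) : |cutWeightDeriv h a| ≤ 2 := by
  rw [cutWeightDeriv, abs_mul, abs_mul, abs_of_nonneg (le_max_right (Real.cos a - h) 0)]
  have h1 := Real.abs_sin_le_one a
  have h2 : max (Real.cos a - h) 0 ≤ 1 := max_le (by linarith [Real.cos_le_one a]) zero_le_one
  have h3 : (0 : ℝ) ≤ max (Real.cos a - h) 0 := le_max_right _ _
  have : |(-2 : ℝ)| = 2 := by norm_num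
  rw [this]
  nlinarith [abs_nonneg (Real.sin a), mul_le_one₀ h1 h3 h2]

theorem cos_sq_sub_le_cutWeight (hh : 0 ≤ h) {a : ℝ} (ha : 0 ≤ Real.cos a) :
    Real.cos a ^ 2 - 2 * h ≤ cutWeight h a := by
  have h1 := Real.cos_le_one a
  rcases le_total (Real.cos a) h with h2 | h2
  · rw [cutWeight_of_cos_le h2]; nlinarith
  · rw [cutWeight, max_eq_left (by linarith)]; nlinarith

theorem abs_cutWeightDeriv_add_le (hh : 0 ≤ h) {a : ℝ} (ha : 0 ≤ Real.cos a) :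
    |cutWeightDeriv h a + Real.sin (2 * a)| ≤ 2 * h := by
  rw [cutWeightDeriv, Real.sin_two_mul,
    show -2 * Real.sin a * max (Real.cos a - h) 0 + 2 * Real.sin a * Real.cos a
      = 2 * (Real.sin a * (Real.cos a - max (Real.cos a - h) 0)) by ring, abs_mul, abs_mul,
    abs_two]
  have h1 := max_cos_sub_le hh ha
  have h2 : |Real.cos a - max (Real.cos a - h) 0| ≤ h := by
    rw [abs_of_nonneg (by linarith)]
    linarith [le_max_left (Real.cos a - h) 0]
  have := mul_le_mul (Real.abs_sin_le_one a) h2 (abs_nonneg _) zero_le_one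
  linarith

/-- The quantity $|\sin(b-a)|$ measures distance on the circle of directions, where $-\pi/2$ and
$\pi/2$ coincide. Cosine is Lipschitz for it because it takes the same value at both ends. -/
theorem abs_cos_sub_cos_le {a b : ℝ} (ha : 0 ≤ Real.cos a) (hb : 0 ≤ Real.cos b) :
    |Real.cos a - Real.cos b| ≤ |Real.sin (b - a)| := by
  have key : ∀ x y : ℝ, 0 ≤ Real.cos x → Real.cos y ≤ Real.cos x + |Real.sin (y - x)| := by
    intro x y hx
    have e : Real.cos y = Real.cos x * Real.cos (y - x) - Real.sin x * Real.sin (y - x) := by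
      rw [← Real.cos_add]; ring_nf
    have h1 : Real.cos x * Real.cos (y - x) ≤ Real.cos x * 1 :=
      mul_le_mul_of_nonneg_left (Real.cos_le_one _) hx
    have h2 : |Real.sin x * Real.sin (y - x)| ≤ 1 * |Real.sin (y - x)| := by
      rw [abs_mul]; exact mul_le_mul_of_nonneg_right (Real.abs_sin_le_one x) (abs_nonneg _)
    linarith [(abs_le.1 h2).1]
  have h1 := key a b ha
  have h2 := key b a hb
  rw [show a - b = -(b - a) by ring, Real.sin_neg, abs_neg] at h2
  rw [abs_le]; constructor <;> linarith

/-- `cutWeightDeriv` is Lipschitz for the projective distance `|sin (b - a)|`. -/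
theorem abs_cutWeightDeriv_sub_le (hh : 0 ≤ h) {a b : ℝ} (ha : 0 ≤ Real.cos a)
    (hb : 0 ≤ Real.cos b) :
    |cutWeightDeriv h a - cutWeightDeriv h b| ≤ 6 * |Real.sin (b - a)| := by
  have hcc := abs_cos_sub_cos_le ha hb
  have ea : Real.cos a = Real.cos b * Real.cos (b - a) + Real.sin b * Real.sin (b - a) := by
    rw [← Real.cos_sub]; ring_nf
  have eb : Real.cos b = Real.cos a * Real.cos (b - a) - Real.sin a * Real.sin (b - a) := by
    rw [← Real.cos_add]; ring_nf
  have esa : Real.sin a = Real.sin b * Real.cos (b - a) - Real.cos b * Real.sin (b - a) := by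
    rw [← Real.sin_sub]; ring_nf
  set d := b - a
  have m1 := max_cos_sub_le hh ha
  have m2 := max_cos_sub_le hh hb
  have n1 : 0 ≤ max (Real.cos a - h) 0 := le_max_right _ _
  have n2 : 0 ≤ max (Real.cos b - h) 0 := le_max_right _ _
  have hs0 := abs_nonneg (Real.sin d)
  have sb1 := Real.abs_sin_le_one b
  have sa1 := Real.abs_sin_le_one a
  have ca1 := Real.cos_le_one a
  have cb1 := Real.cos_le_one b
  unfold cutWeightDeriv
  -- If $\cos d\ge0$ the angles are close in the ordinary sense. If $\cos d\le0$, closeness can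
  -- occur only across the ends $\pm\pi/2$, where the sines have opposite signs; then both cosines
  -- are at most $|\sin d|$.
  rcases le_total 0 (Real.cos d) with hd | hd
  · have hm : |max (Real.cos a - h) 0 - max (Real.cos b - h) 0| ≤ |Real.sin d| := by
      refine (abs_max_sub_max_le_abs _ _ _).trans ?_
      simpa using hcc
    have hs : |Real.sin a - Real.sin b| ≤ 2 * |Real.sin d| := by
      have h1 : 1 - Real.cos d ≤ |Real.sin d| := by
        have h2 : |Real.sin d| ^ 2 = 1 - Real.cos d ^ 2 := by
          rw [sq_abs]; linarith [Real.sin_sq_add_cos_sq d]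
        nlinarith [Real.abs_sin_le_one d, Real.cos_le_one d]
      have h3 : |Real.sin b * (1 - Real.cos d)| ≤ 1 * |Real.sin d| := by
        rw [abs_mul, abs_of_nonneg (by linarith [Real.cos_le_one d] : 0 ≤ 1 - Real.cos d)]
        exact mul_le_mul sb1 h1 (by linarith [Real.cos_le_one d]) zero_le_one
      have h4 : |Real.cos b * Real.sin d| ≤ 1 * |Real.sin d| := by
        rw [abs_mul]
        exact mul_le_mul_of_nonneg_right (Real.abs_cos_le_one b) hs0
      have e : Real.sin a - Real.sin b = -(Real.sin b * (1 - Real.cos d))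
          - Real.cos b * Real.sin d := by rw [esa]; ring
      rw [e]
      have := abs_le.1 h3; have := abs_le.1 h4
      rw [abs_le]; constructor <;> linarith
    have e : -2 * Real.sin a * max (Real.cos a - h) 0 - -2 * Real.sin b * max (Real.cos b - h) 0
        = -2 * ((Real.sin a - Real.sin b) * max (Real.cos a - h) 0
          + Real.sin b * (max (Real.cos a - h) 0 - max (Real.cos b - h) 0)) := by ring
    rw [e, abs_mul, show |(-2 : ℝ)| = 2 by norm_num]
    have h5 : |(Real.sin a - Real.sin b) * max (Real.cos a - h) 0| ≤ 2 * |Real.sin d| * 1 := by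
      rw [abs_mul, abs_of_nonneg n1]
      exact mul_le_mul hs (by linarith) n1 (by positivity)
    have h6 : |Real.sin b * (max (Real.cos a - h) 0 - max (Real.cos b - h) 0)|
        ≤ 1 * |Real.sin d| := by
      rw [abs_mul]; exact mul_le_mul sb1 hm (abs_nonneg _) zero_le_one
    linarith [abs_add_le ((Real.sin a - Real.sin b) * max (Real.cos a - h) 0)
      (Real.sin b * (max (Real.cos a - h) 0 - max (Real.cos b - h) 0))]
  · have k1 : Real.cos a ≤ |Real.sin d| := by
      have h1 : |Real.sin b * Real.sin d| ≤ 1 * |Real.sin d| := by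
        rw [abs_mul]; exact mul_le_mul_of_nonneg_right sb1 hs0
      nlinarith [(abs_le.1 h1).2, mul_nonneg hb (neg_nonneg.2 hd)]
    have k2 : Real.cos b ≤ |Real.sin d| := by
      have h1 : |Real.sin a * Real.sin d| ≤ 1 * |Real.sin d| := by
        rw [abs_mul]; exact mul_le_mul_of_nonneg_right sa1 hs0
      nlinarith [(abs_le.1 h1).1, mul_nonneg ha (neg_nonneg.2 hd)]
    have h5 : |Real.sin a * max (Real.cos a - h) 0| ≤ 1 * |Real.sin d| := by
      rw [abs_mul, abs_of_nonneg n1]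
      exact mul_le_mul sa1 (by linarith) n1 zero_le_one
    have h6 : |Real.sin b * max (Real.cos b - h) 0| ≤ 1 * |Real.sin d| := by
      rw [abs_mul, abs_of_nonneg n2]
      exact mul_le_mul sb1 (by linarith) n2 zero_le_one
    have := abs_le.1 h5; have := abs_le.1 h6
    rw [abs_le]; constructor <;> linarith

/-- Pointwise lower bound of the symmetrised truncated kernel. -/
theorem kernel_lower {μ : ℝ} (hμ : 0 < μ) (hh : 0 ≤ h) {a b : ℝ} (ha : 0 ≤ Real.cos a)
    (hb : 0 ≤ Real.cos b) (hd : Real.sin (b - a) ≠ 0) :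
    (1 / 2) * (Real.cos a ^ 2 + Real.cos b ^ 2) * (1 / (Real.sin (b - a) ^ 2 + μ ^ 2))
        + Real.cos a ^ 2 + Real.cos b ^ 2 - 1
        - 8 * (μ ^ 2 / (Real.sin (b - a) ^ 2 + μ ^ 2)) - (2 * h / μ ^ 2 + 2 * h / μ)
      ≤ (1 / 2) * ((cutWeight h a / Real.sin (b - a) ^ 2
          + cutWeightDeriv h a * (Real.cos (b - a) / Real.sin (b - a)))
        + (cutWeight h b / Real.sin (a - b) ^ 2
          + cutWeightDeriv h b * (Real.cos (a - b) / Real.sin (a - b)))) := by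
  rw [show a - b = -(b - a) by ring, Real.sin_neg, Real.cos_neg, neg_sq]
  have hlip := abs_cutWeightDeriv_sub_le hh ha hb
  have ua := abs_cutWeightDeriv_add_le hh ha
  have ub := abs_cutWeightDeriv_add_le hh hb
  have wa := cos_sq_sub_le_cutWeight hh ha
  have wb := cos_sq_sub_le_cutWeight hh hb
  have wa0 := cutWeight_nonneg (h := h) a
  have wb0 := cutWeight_nonneg (h := h) b
  -- For the untruncated weight $\cos^2$, with derivative $-\sin 2a$, the cotangent term is exactly
  -- $\cos(b-a)\cos(b+a)$.
  have hS : (1 / 2) * (Real.cos (b - a) / Real.sin (b - a))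
      * (Real.sin (2 * b) - Real.sin (2 * a)) = Real.cos a ^ 2 + Real.cos b ^ 2 - 1 := by
    have e : Real.sin (2 * b) - Real.sin (2 * a)
        = 2 * (Real.sin (b - a) * Real.cos (b + a)) := by
      rw [Real.sin_sub_sin]; ring_nf
    have e2 : Real.cos (b - a) * Real.cos (b + a) = Real.cos a ^ 2 + Real.cos b ^ 2 - 1 := by
      rw [Real.cos_sub, Real.cos_add]
      nlinarith [Real.sin_sq_add_cos_sq a, Real.sin_sq_add_cos_sq b]
    rw [e, ← e2]; field_simp
  have hSle : |Real.cos a ^ 2 + Real.cos b ^ 2 - 1| ≤ 1 := by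
    have := Real.cos_sq_le_one a; have := Real.cos_sq_le_one b
    rw [abs_le]; constructor <;> nlinarith
  set d := b - a
  set x := Real.sin d with hx
  have hx2 : 0 < x ^ 2 := by positivity
  have hxa : 0 < |x| := abs_pos.2 hd
  have hτ : 1 / (x ^ 2 + μ ^ 2) ≤ 1 / x ^ 2 :=
    one_div_le_one_div_of_le hx2 (by nlinarith)
  have hτ0 : 0 ≤ 1 / (x ^ 2 + μ ^ 2) := by positivity
  have hτμ : 1 / (x ^ 2 + μ ^ 2) ≤ 1 / μ ^ 2 := (le_abs_self _).trans (inv_reg_le hμ x)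
  have p1 : (1 / 2) * (Real.cos a ^ 2 + Real.cos b ^ 2) * (1 / (x ^ 2 + μ ^ 2)) - 2 * h / μ ^ 2
      ≤ (1 / 2) * (cutWeight h a / x ^ 2 + cutWeight h b / x ^ 2) := by
    have e1 : (1 / 2) * (cutWeight h a / x ^ 2 + cutWeight h b / x ^ 2)
        = (1 / 2) * (cutWeight h a + cutWeight h b) * (1 / x ^ 2) := by ring
    have e2 : (1 / 2) * (cutWeight h a + cutWeight h b) * (1 / (x ^ 2 + μ ^ 2))
        ≤ (1 / 2) * (cutWeight h a + cutWeight h b) * (1 / x ^ 2) :=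
      mul_le_mul_of_nonneg_left hτ (by positivity)
    have e3 : (1 / 2) * (Real.cos a ^ 2 + Real.cos b ^ 2 - 4 * h) * (1 / (x ^ 2 + μ ^ 2))
        ≤ (1 / 2) * (cutWeight h a + cutWeight h b) * (1 / (x ^ 2 + μ ^ 2)) :=
      mul_le_mul_of_nonneg_right (by linarith) hτ0
    have e4 : 2 * h * (1 / (x ^ 2 + μ ^ 2)) ≤ 2 * h * (1 / μ ^ 2) :=
      mul_le_mul_of_nonneg_left hτμ (by positivity)
    have e5 : 2 * h / μ ^ 2 = 2 * h * (1 / μ ^ 2) := by ring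
    rw [e1, e5]
    linarith
  have hcx : |Real.cos d / x| ≤ 1 / |x| := by
    rw [abs_div]; exact div_le_div_of_nonneg_right (Real.abs_cos_le_one d) (abs_nonneg _)
  have p2 : Real.cos a ^ 2 + Real.cos b ^ 2 - 1 - 8 * (μ ^ 2 / (x ^ 2 + μ ^ 2)) - 2 * h / μ
      ≤ (1 / 2) * (Real.cos d / x) * (cutWeightDeriv h a - cutWeightDeriv h b) := by
    have hf0 : 0 ≤ μ ^ 2 / (x ^ 2 + μ ^ 2) := deficit_nonneg x
    -- For $|x|\le\mu$ the deficit is at least $1/2$, so eight times it absorbs the Lipschitz bound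
    -- $3$ and the target's bound $1$. For $|x|\ge\mu$ the cotangent is at most $1/\mu$ and the
    -- truncation error is $O(h/\mu)$.
    rcases le_total |x| μ with hxm | hxm
    · have h1 : |(1 / 2) * (Real.cos d / x) * (cutWeightDeriv h a - cutWeightDeriv h b)| ≤ 3 := by
        rw [abs_mul, abs_mul, abs_of_pos (by norm_num : (0:ℝ) < 1 / 2)]
        calc 1 / 2 * |Real.cos d / x| * |cutWeightDeriv h a - cutWeightDeriv h b|
            ≤ 1 / 2 * (1 / |x|) * (6 * |x|) := by gcongr
          _ = 3 := by field_simp; norm_num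
      have h2 : 1 / 2 ≤ μ ^ 2 / (x ^ 2 + μ ^ 2) := by
        rw [div_le_div_iff₀ (by norm_num) (by positivity)]
        have : x ^ 2 ≤ μ ^ 2 := by rw [← sq_abs]; exact pow_le_pow_left₀ (abs_nonneg _) hxm 2
        linarith
      have h3 : 0 ≤ 2 * h / μ := by positivity
      linarith [(abs_le.1 h1).1, (abs_le.1 hSle).2]
    · have e : (1 / 2) * (Real.cos d / x) * (cutWeightDeriv h a - cutWeightDeriv h b)
          = (1 / 2) * (Real.cos d / x) * ((cutWeightDeriv h a + Real.sin (2 * a))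
            - (cutWeightDeriv h b + Real.sin (2 * b)))
            + (1 / 2) * (Real.cos d / x) * (Real.sin (2 * b) - Real.sin (2 * a)) := by ring
      have h1 : |(1 / 2) * (Real.cos d / x) * ((cutWeightDeriv h a + Real.sin (2 * a))
            - (cutWeightDeriv h b + Real.sin (2 * b)))| ≤ 2 * h / μ := by
        have h2 : |(cutWeightDeriv h a + Real.sin (2 * a))
            - (cutWeightDeriv h b + Real.sin (2 * b))| ≤ 4 * h := by
          have := abs_le.1 ua; have := abs_le.1 ub
          rw [abs_le]; constructor <;> linarith
        have h3 : |Real.cos d / x| ≤ 1 / μ := hcx.trans (one_div_le_one_div_of_le hμ hxm)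
        rw [abs_mul, abs_mul, abs_of_pos (by norm_num : (0:ℝ) < 1 / 2)]
        calc _ ≤ 1 / 2 * (1 / μ) * (4 * h) := by gcongr
          _ = 2 * h / μ := by ring
      rw [e, hS]
      linarith [(abs_le.1 h1).1]
  have e : cutWeightDeriv h b * (Real.cos d / -x) = -(cutWeightDeriv h b * (Real.cos d / x)) := by
    rw [div_neg]; ring
  rw [e]
  linarith

end cutWeight

/-! ### The conjugate-function pairing of a profile -/

theorem cos_nonneg_of_mem_period {a : ℝ} (ha : a ∈ Ioc (-(Real.pi / 2)) (Real.pi / 2)) :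
    0 ≤ Real.cos a := Real.cos_nonneg_of_mem_Icc ⟨ha.1.le, ha.2⟩

theorem ae_mem_period : ∀ᵐ a ∂angleMeasure, a ∈ Ioc (-(Real.pi / 2)) (Real.pi / 2) :=
  ae_restrict_mem measurableSet_Ioc

theorem ae_mem_period_prod : ∀ᵐ z ∂(angleMeasure.prod angleMeasure),
    z ∈ Ioc (-(Real.pi / 2)) (Real.pi / 2) ×ˢ Ioc (-(Real.pi / 2)) (Real.pi / 2) := by
  rw [Measure.prod_restrict]
  exact ae_restrict_mem (measurableSet_Ioc.prod measurableSet_Ioc)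

theorem sin_sub_ne_zero_of_mem_period {a b : ℝ}
    (ha : a ∈ Ioc (-(Real.pi / 2)) (Real.pi / 2)) (hb : b ∈ Ioc (-(Real.pi / 2)) (Real.pi / 2))
    (hab : a ≠ b) : Real.sin (b - a) ≠ 0 := by
  intro h
  have h1 := (Real.sin_eq_zero_iff_of_lt_of_lt (by linarith [ha.2, hb.1])
    (by linarith [ha.1, hb.2])).1 h
  exact hab (by linarith)

theorem measurable_real_tan : Measurable Real.tan := by
  rw [show Real.tan = fun x => Real.sin x / Real.cos x from funext Real.tan_eq_sin_div_cos]
  fun_prop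

theorem abs_tan_le_of_le_cos {h a : ℝ} (hh : 0 < h) (ha : h ≤ Real.cos a) :
    |Real.tan a| ≤ 1 / h := by
  rw [Real.tan_eq_sin_div_cos, abs_div, abs_of_pos (hh.trans_le ha)]
  exact div_le_div₀ zero_le_one (Real.abs_sin_le_one a) hh ha

theorem abs_mul_cot_le {x s c K : ℝ} (hK : 0 ≤ K) (hx : |x| ≤ K * |s|) (hc : |c| ≤ 1) :
    |x * (c / s)| ≤ K := by
  -- At $s=0$ the quotient is $0$ by convention, so the bound holds on the diagonal too.
  rcases eq_or_ne s 0 with rfl | hs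
  · simpa using hK
  · have hs' : 0 < |s| := abs_pos.2 hs
    rw [abs_mul, abs_div]
    calc |x| * (|c| / |s|) ≤ (K * |s|) * (1 / |s|) := by gcongr
      _ = K := by field_simp

section profile
variable {p p' : ℝ → ℝ} {C h : ℝ}

/-- If $\cos b\ge h/2$, both tangents lie in a compact interval where $p'$ is bounded, and $\tan
b-\tan a=\sin(b-a)/(\cos a\cos b)$. Otherwise $|\sin(b-a)|\ge h/2$ and boundedness of $p$ suffices.
This tames the cotangent singularity without any control of $p'$ at infinity. -/
theorem exists_sine_lipschitz (hp : ∀ x, HasDerivAt p (p' x) x) (hp' : Continuous p')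
    (hC : ∀ x, |p x| ≤ C) (hh : 0 < h) :
    ∃ K : ℝ, 0 ≤ K ∧ ∀ a b, h ≤ Real.cos a → 0 ≤ Real.cos b →
      |p (Real.tan b) - p (Real.tan a)| ≤ K * |Real.sin (b - a)| := by
  have hC0 : 0 ≤ C := (abs_nonneg _).trans (hC 0)
  obtain ⟨K₁, hK₁⟩ :=
    (isCompact_Icc (a := -(1 / (h / 2))) (b := 1 / (h / 2))).exists_bound_of_continuousOn
      hp'.continuousOn
  have hK₁0 : 0 ≤ K₁ := (norm_nonneg _).trans (hK₁ 0 ⟨by simp; positivity, by positivity⟩)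
  refine ⟨K₁ * (2 / h ^ 2) + 4 * C / h, by positivity, fun a b ha hb => ?_⟩
  have hs := abs_nonneg (Real.sin (b - a))
  rcases le_total (h / 2) (Real.cos b) with hbc | hbc
  · have ha' : h / 2 ≤ Real.cos a := by linarith
    have ta := abs_tan_le_of_le_cos (by positivity) ha'
    have tb := abs_tan_le_of_le_cos (by positivity) hbc
    have h1 := (convex_Icc (-(1 / (h / 2)))
      (1 / (h / 2))).norm_image_sub_le_of_norm_hasDerivWithin_le
      (fun x _ => (hp x).hasDerivWithinAt) hK₁ (abs_le.1 ta) (abs_le.1 tb)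
    rw [Real.norm_eq_abs, Real.norm_eq_abs] at h1
    have ca : 0 < Real.cos a := hh.trans_le ha
    have cb : 0 < Real.cos b := by linarith
    have e : Real.tan b - Real.tan a = Real.sin (b - a) / (Real.cos b * Real.cos a) := by
      rw [Real.tan_eq_sin_div_cos, Real.tan_eq_sin_div_cos, Real.sin_sub]
      field_simp
    have h2 : |Real.tan b - Real.tan a| ≤ |Real.sin (b - a)| / (h / 2 * h) := by
      rw [e, abs_div, abs_of_pos (mul_pos cb ca)]
      gcongr
    calc _ ≤ K₁ * (|Real.sin (b - a)| / (h / 2 * h)) := h1.trans (by gcongr)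
      _ = K₁ * (2 / h ^ 2) * |Real.sin (b - a)| := by field_simp
      _ ≤ _ := by
        have : 0 ≤ 4 * C / h * |Real.sin (b - a)| := by positivity
        linarith
  · have h1 := abs_cos_sub_cos_le (by linarith : 0 ≤ Real.cos a) hb
    have h2 : h / 2 ≤ |Real.sin (b - a)| := by
      linarith [le_abs_self (Real.cos a - Real.cos b)]
    have h3 : |p (Real.tan b) - p (Real.tan a)| ≤ 2 * C := by
      have := abs_le.1 (hC (Real.tan b)); have := abs_le.1 (hC (Real.tan a))
      rw [abs_le]; constructor <;> linarith
    calc _ ≤ 2 * C := h3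
      _ = 4 * C / h * (h / 2) := by field_simp; ring
      _ ≤ 4 * C / h * |Real.sin (b - a)| := by gcongr
      _ ≤ _ := by
        have : 0 ≤ K₁ * (2 / h ^ 2) * |Real.sin (b - a)| := by positivity
        linarith

theorem exists_bound_cutWeight_mul (hp' : Continuous p') (hh : 0 < h) :
    ∃ K : ℝ, 0 ≤ K ∧ ∀ a, 0 ≤ Real.cos a →
      |cutWeight h a * (p' (Real.tan a) * (1 / Real.cos a ^ 2))| ≤ K := by
  obtain ⟨K₁, hK₁⟩ := (isCompact_Icc (a := -(1 / h)) (b := 1 / h)).exists_bound_of_continuousOn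
    hp'.continuousOn
  have hK₁0 : 0 ≤ K₁ := (norm_nonneg _).trans (hK₁ 0 ⟨by simp; positivity, by positivity⟩)
  refine ⟨K₁, hK₁0, fun a ha0 => ?_⟩
  rcases le_total (Real.cos a) h with ha | ha
  · rw [cutWeight_of_cos_le ha]; simpa using hK₁0
  · have h1 := hK₁ _ (abs_le.1 (abs_tan_le_of_le_cos hh ha))
    rw [Real.norm_eq_abs] at h1
    have hc : 0 < Real.cos a := hh.trans_le ha
    have h2 := cutWeight_le_cos_sq hh.le hc.le
    rw [abs_mul, abs_mul, abs_of_nonneg (cutWeight_nonneg a),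
      abs_of_nonneg (by positivity : 0 ≤ 1 / Real.cos a ^ 2)]
    calc _ ≤ Real.cos a ^ 2 * (K₁ * (1 / Real.cos a ^ 2)) := by gcongr
      _ = K₁ := by field_simp

theorem hasDerivAt_comp_tan (hp : ∀ x, HasDerivAt p (p' x) x) {a : ℝ} (ha : Real.cos a ≠ 0) :
    HasDerivAt (fun a => p (Real.tan a)) (p' (Real.tan a) * (1 / Real.cos a ^ 2)) a :=
  HasDerivAt.comp (h₂ := p) a (hp _) (Real.hasDerivAt_tan ha)

theorem abs_conjugate_kernel_le {K K₂ : ℝ} (hK : 0 ≤ K) (hK₂ : 0 ≤ K₂)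
    (hL : ∀ a b, h ≤ Real.cos a → 0 ≤ Real.cos b →
      |p (Real.tan b) - p (Real.tan a)| ≤ K * |Real.sin (b - a)|)
    (hB : ∀ a, 0 ≤ Real.cos a → |cutWeight h a * (p' (Real.tan a) * (1 / Real.cos a ^ 2))| ≤ K₂)
    {a b : ℝ} (ha : 0 ≤ Real.cos a) (hb : 0 ≤ Real.cos b) :
    |cutWeight h a * (p' (Real.tan a) * (1 / Real.cos a ^ 2)) *
        ((p (Real.tan b) - p (Real.tan a)) * (Real.cos (b - a) / Real.sin (b - a)))| ≤ K₂ * K := by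
  rcases le_total (Real.cos a) h with hc | hc
  · rw [cutWeight_of_cos_le hc]; simp; positivity
  · rw [abs_mul]
    exact mul_le_mul (hB a ha) (abs_mul_cot_le hK (hL a b hc hb) (Real.abs_cos_le_one _))
      (abs_nonneg _) hK₂

theorem abs_square_kernel_le {K : ℝ} (hh : 0 < h)
    (hL : ∀ a b, h ≤ Real.cos a → 0 ≤ Real.cos b →
      |p (Real.tan b) - p (Real.tan a)| ≤ K * |Real.sin (b - a)|)
    {a b : ℝ} (hb : 0 ≤ Real.cos b) :
    |(p (Real.tan a) - p (Real.tan b)) ^ 2 * (cutWeight h a / Real.sin (b - a) ^ 2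
        + cutWeightDeriv h a * (Real.cos (b - a) / Real.sin (b - a)))| ≤ 3 * K ^ 2 := by
  rcases le_total (Real.cos a) h with hc | hc
  · rw [cutWeight_of_cos_le hc, cutWeightDeriv_of_cos_le hc]; simp; positivity
  · have h1 := hL a b hc hb
    rw [abs_sub_comm] at h1
    set D := p (Real.tan a) - p (Real.tan b)
    set s := Real.sin (b - a)
    have hD2 : |D| ^ 2 ≤ (K * |s|) ^ 2 := pow_le_pow_left₀ (abs_nonneg _) h1 2
    have hs1 : |s| ≤ 1 := Real.abs_sin_le_one _
    have k1 : |D ^ 2 * (cutWeight h a / s ^ 2)| ≤ K ^ 2 := by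
      rcases eq_or_ne s 0 with h0 | h0
      · rw [h0]; simp; positivity
      · have : 0 < s ^ 2 := by positivity
        rw [abs_of_nonneg (mul_nonneg (sq_nonneg _) (div_nonneg (cutWeight_nonneg a) this.le)),
          ← sq_abs D]
        calc |D| ^ 2 * (cutWeight h a / s ^ 2) ≤ (K * |s|) ^ 2 * (1 / s ^ 2) :=
              mul_le_mul hD2 (div_le_div_of_nonneg_right (cutWeight_le_one hh.le a) this.le)
                (div_nonneg (cutWeight_nonneg a) this.le) (by positivity)
          _ = K ^ 2 := by rw [mul_pow, sq_abs]; field_simp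
    have k2 : |D ^ 2 * cutWeightDeriv h a * (Real.cos (b - a) / s)| ≤ 2 * K ^ 2 := by
      refine abs_mul_cot_le (by positivity) ?_ (Real.abs_cos_le_one _)
      rw [abs_mul, abs_pow]
      calc |D| ^ 2 * |cutWeightDeriv h a| ≤ (K * |s|) ^ 2 * 2 :=
            mul_le_mul hD2 (abs_cutWeightDeriv_le hh.le a) (abs_nonneg _) (by positivity)
        _ = 2 * K ^ 2 * |s| * |s| := by ring
        _ ≤ 2 * K ^ 2 * |s| * 1 := by gcongr
        _ = _ := by ring
    rw [mul_add, ← mul_assoc (D ^ 2) (cutWeightDeriv h a)]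
    linarith [abs_add_le (D ^ 2 * (cutWeight h a / s ^ 2))
      (D ^ 2 * cutWeightDeriv h a * (Real.cos (b - a) / s))]

theorem cutWeight_eventuallyEq_zero {a : ℝ} (ha : Real.cos a < h) : cutWeight h =ᶠ[𝓝 a] 0 := by
  filter_upwards [Real.continuous_cos.continuousAt.eventually (gt_mem_nhds ha)] with x hx
  exact cutWeight_of_cos_le (le_of_lt hx)

/-- Integration by parts in the conjugate-function integral of a truncated profile. -/
theorem integral_conjugate_eq (hp : ∀ x, HasDerivAt p (p' x) x) (hp' : Continuous p')
    (hC : ∀ x, |p x| ≤ C) (hh : 0 < h) {b : ℝ}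
    (hb : b ∈ Ioc (-(Real.pi / 2)) (Real.pi / 2)) :
    ∫ a, cutWeight h a * (p' (Real.tan a) * (1 / Real.cos a ^ 2)) *
        ((p (Real.tan b) - p (Real.tan a)) * (Real.cos (b - a) / Real.sin (b - a))) ∂angleMeasure
      = (1 / 2) * ∫ a, (p (Real.tan a) - p (Real.tan b)) ^ 2 *
        (cutWeight h a / Real.sin (b - a) ^ 2
          + cutWeightDeriv h a * (Real.cos (b - a) / Real.sin (b - a))) ∂angleMeasure := by
  have hpm : Measurable p :=
    (continuous_iff_continuousAt.2 fun x => (hp x).continuousAt).measurable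
  have hp'm := hp'.measurable
  have htan := measurable_real_tan
  have hw := measurable_cutWeight (h := h)
  have hw' := measurable_cutWeightDeriv (h := h)
  have hcb := cos_nonneg_of_mem_period hb
  obtain ⟨K, hK, hL⟩ := exists_sine_lipschitz hp hp' hC hh
  obtain ⟨K₂, hK₂, hB⟩ := exists_bound_cutWeight_mul hp' hh
  have iF : Integrable (fun a => cutWeight h a * (p' (Real.tan a) * (1 / Real.cos a ^ 2)) *
      ((p (Real.tan b) - p (Real.tan a)) * (Real.cos (b - a) / Real.sin (b - a))))
      angleMeasure := by
    refine Integrable.of_bound (by fun_prop) (K₂ * K) ?_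
    filter_upwards [ae_mem_period] with a ha
    exact abs_conjugate_kernel_le hK hK₂ hL hB (cos_nonneg_of_mem_period ha) hcb
  have iG : Integrable (fun a => (p (Real.tan a) - p (Real.tan b)) ^ 2 *
      (cutWeight h a / Real.sin (b - a) ^ 2
        + cutWeightDeriv h a * (Real.cos (b - a) / Real.sin (b - a)))) angleMeasure := by
    refine Integrable.of_bound (by fun_prop) (3 * K ^ 2) ?_
    filter_upwards [ae_mem_period] with a ha
    exact abs_square_kernel_le hh hL hcb
  have key := ((iG.hasIntegralValue).sub (iF.hasIntegralValue.const_mul 2))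
  have hpi := Real.pi_pos
  have hend : ∀ x, Real.cos x = 0 → cutWeight h =ᶠ[𝓝 x] 0 := fun x hx =>
    cutWeight_eventuallyEq_zero (by rw [hx]; exact hh)
  -- The derivative of this function is the difference of the two integrands, up to the factor $2$;
  -- the weight makes it vanish at both ends.
  set ψ : ℝ → ℝ := fun a => (p (Real.tan b) - p (Real.tan a)) ^ 2 *
    (cutWeight h a * (Real.cos (b - a) / Real.sin (b - a))) with hψ
  have hψ0 : ∀ x, Real.cos x < h → ψ =ᶠ[𝓝 x] 0 := by
    intro x hx
    filter_upwards [cutWeight_eventuallyEq_zero hx] with y hy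
    simp only [hψ, hy, Pi.zero_apply, zero_mul, mul_zero]
  have hder : ∀ x ∈ Ioo (-(Real.pi / 2)) (Real.pi / 2) \ {b}, HasDerivAt ψ
      ((p (Real.tan x) - p (Real.tan b)) ^ 2 *
        (cutWeight h x / Real.sin (b - x) ^ 2
          + cutWeightDeriv h x * (Real.cos (b - x) / Real.sin (b - x)))
        - 2 * (cutWeight h x * (p' (Real.tan x) * (1 / Real.cos x ^ 2)) *
        ((p (Real.tan b) - p (Real.tan x)) * (Real.cos (b - x) / Real.sin (b - x))))) x := by
    rintro x ⟨hx, hxb⟩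
    have hcx : Real.cos x ≠ 0 := (Real.cos_pos_of_mem_Ioo hx).ne'
    have hs : Real.sin (b - x) ≠ 0 :=
      sin_sub_ne_zero_of_mem_period ⟨hx.1, hx.2.le⟩ hb hxb
    have d1 := hasDerivAt_comp_tan hp hcx
    have d2 : HasDerivAt (fun y => b - y) (-1) x := by
      simpa using (hasDerivAt_id x).const_sub b
    have d3 := (d2.cos).div (d2.sin) hs
    have d4 := (((d1.const_sub (p (Real.tan b))).pow 2).mul
      ((hasDerivAt_cutWeight (h := h) x).mul d3))
    refine d4.congr_deriv ?_
    have := Real.sin_sq_add_cos_sq (b - x)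
    simp only [Pi.div_apply, Pi.pow_apply, Pi.mul_apply]
    have e : (-Real.sin (b - x) * -1 * Real.sin (b - x) - Real.cos (b - x) *
        (Real.cos (b - x) * -1)) / Real.sin (b - x) ^ 2 = 1 / Real.sin (b - x) ^ 2 := by
      congr 1; nlinarith
    rw [e]
    push_cast
    ring
  have hcont : ContinuousOn ψ (Icc (-(Real.pi / 2)) (Real.pi / 2)) := by
    intro x hx
    refine ContinuousAt.continuousWithinAt ?_
    rcases lt_or_ge (Real.cos x) h with hc | hc
    · exact (continuousAt_const (y := (0 : ℝ))).congr (hψ0 x hc).symm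
    · have hx' : x ∈ Ioo (-(Real.pi / 2)) (Real.pi / 2) := by
        refine ⟨lt_of_le_of_ne hx.1 fun he => ?_, lt_of_le_of_ne hx.2 fun he => ?_⟩
        · rw [← he, Real.cos_neg, Real.cos_pi_div_two] at hc; linarith
        · rw [he, Real.cos_pi_div_two] at hc; linarith
      -- At $b$ the cotangent is singular, but the squared increment makes the function
      -- $O(|\sin(b-y)|)$, hence continuous with value $0$.
      by_cases hxb : x = b
      · have hψx : ψ x = 0 := by simp [hψ, hxb]
        rw [ContinuousAt, hψx]
        have hcos0 : ∀ᶠ y in 𝓝 x, 0 < Real.cos y :=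
          Real.continuous_cos.continuousAt.eventually (lt_mem_nhds (hh.trans_le hc))
        refine squeeze_zero_norm' (a := fun y => K ^ 2 * |Real.sin (b - y)|) ?_ ?_
        · filter_upwards [hcos0] with y hy
          rw [Real.norm_eq_abs]
          rcases le_total (Real.cos y) h with hcy | hcy
          · simp only [hψ, cutWeight_of_cos_le hcy, zero_mul, mul_zero, abs_zero]
            positivity
          · have h1 := hL y b hcy hcb
            simp only [hψ]
            rw [← mul_assoc]
            refine abs_mul_cot_le (by positivity) ?_ (Real.abs_cos_le_one _)
            rw [abs_mul, abs_pow, abs_of_nonneg (cutWeight_nonneg y)]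
            calc _ ≤ (K * |Real.sin (b - y)|) ^ 2 * 1 :=
                  mul_le_mul (pow_le_pow_left₀ (abs_nonneg _) h1 2) (cutWeight_le_one hh.le y)
                    (cutWeight_nonneg y) (by positivity)
              _ = _ := by ring
        · have : ContinuousAt (fun y => K ^ 2 * |Real.sin (b - y)|) x := by fun_prop
          simpa [ContinuousAt, hxb] using this
      · exact (hder x ⟨hx', hxb⟩).continuousAt
  have hFTC := integral_eq_of_hasDerivAt_off_countable_of_le ψ _
    (by linarith : -(Real.pi / 2) ≤ Real.pi / 2) (countable_singleton b) hcont hder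
    ((intervalIntegrable_iff_integrableOn_Ioc_of_le (by linarith)).2 key.1)
  rw [← integral_angleMeasure, key.2, (hψ0 _ (by rw [Real.cos_pi_div_two]; exact hh)).self_of_nhds,
    (hψ0 _ (by rw [Real.cos_neg, Real.cos_pi_div_two]; exact hh)).self_of_nhds] at hFTC
  simp only [Pi.zero_apply, sub_self] at hFTC
  linarith

end profile

section profile
variable {p p' : ℝ → ℝ} {C h μ : ℝ}

/-- The conjugate-function pairing of a truncated profile is integrable and bounded below. -/
theorem conjugate_pairing_lower (hp : ∀ x, HasDerivAt p (p' x) x) (hp' : Continuous p')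
    (hC : ∀ x, |p x| ≤ C) (hh : 0 < h) (hμ : 0 < μ) (hμ1 : μ ≤ 1) :
    Integrable (fun a => cutWeight h a * (p' (Real.tan a) * (1 / Real.cos a ^ 2)) *
        ∫ b, (p (Real.tan b) - p (Real.tan a)) * (Real.cos (b - a) / Real.sin (b - a))
          ∂angleMeasure) angleMeasure ∧
    (1 / 8) * (∫ a, p (Real.tan a) * Real.cos (2 * a) ∂angleMeasure) ^ 2
      - C ^ 2 * (20 * Real.pi * kernelDeficit μ
        + 2 * Real.pi ^ 2 * (2 * h / μ ^ 2 + 2 * h / μ))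
      ≤ ∫ a, cutWeight h a * (p' (Real.tan a) * (1 / Real.cos a ^ 2)) *
        (∫ b, (p (Real.tan b) - p (Real.tan a)) * (Real.cos (b - a) / Real.sin (b - a))
          ∂angleMeasure) ∂angleMeasure := by
  have hpi := Real.pi_pos
  have hpm : Measurable p :=
    (continuous_iff_continuousAt.2 fun x => (hp x).continuousAt).measurable
  have hp'm := hp'.measurable
  have htan := measurable_real_tan
  have hw := measurable_cutWeight (h := h)
  have hw' := measurable_cutWeightDeriv (h := h)
  obtain ⟨K, hK, hL⟩ := exists_sine_lipschitz hp hp' hC hh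
  obtain ⟨K₂, hK₂, hB⟩ := exists_bound_cutWeight_mul hp' hh
  have iF : Integrable (fun z : ℝ × ℝ =>
      cutWeight h z.1 * (p' (Real.tan z.1) * (1 / Real.cos z.1 ^ 2)) *
      ((p (Real.tan z.2) - p (Real.tan z.1)) * (Real.cos (z.2 - z.1) / Real.sin (z.2 - z.1))))
      (angleMeasure.prod angleMeasure) := by
    refine Integrable.of_bound (by fun_prop) (K₂ * K) ?_
    filter_upwards [ae_mem_period_prod] with z hz
    exact abs_conjugate_kernel_le hK hK₂ hL hB (cos_nonneg_of_mem_period hz.1)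
      (cos_nonneg_of_mem_period hz.2)
  have iG : Integrable (fun z : ℝ × ℝ => (p (Real.tan z.1) - p (Real.tan z.2)) ^ 2 *
      (cutWeight h z.1 / Real.sin (z.2 - z.1) ^ 2
        + cutWeightDeriv h z.1 * (Real.cos (z.2 - z.1) / Real.sin (z.2 - z.1))))
      (angleMeasure.prod angleMeasure) := by
    refine Integrable.of_bound (by fun_prop) (3 * K ^ 2) ?_
    filter_upwards [ae_mem_period_prod] with z hz
    exact abs_square_kernel_le hh hL (cos_nonneg_of_mem_period hz.2)
  have hinner := iF.integral_prod_left
  simp only [integral_const_mul] at hinner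
  refine ⟨hinner, ?_⟩
  have e1 : ∫ a, cutWeight h a * (p' (Real.tan a) * (1 / Real.cos a ^ 2)) *
        (∫ b, (p (Real.tan b) - p (Real.tan a)) * (Real.cos (b - a) / Real.sin (b - a))
          ∂angleMeasure) ∂angleMeasure
      = (1 / 2) * ∫ z : ℝ × ℝ, (p (Real.tan z.1) - p (Real.tan z.2)) ^ 2 *
      (cutWeight h z.1 / Real.sin (z.2 - z.1) ^ 2
        + cutWeightDeriv h z.1 * (Real.cos (z.2 - z.1) / Real.sin (z.2 - z.1)))
      ∂(angleMeasure.prod angleMeasure) := by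
    have s1 := integral_prod _ iF
    simp only [integral_const_mul] at s1
    -- Fubini puts the $a$-integral inside, so that the integration by parts applies for each fixed
    -- $b$.
    rw [← s1, integral_prod_symm _ iF, integral_prod_symm _ iG, ← integral_const_mul]
    refine integral_congr_ae ?_
    filter_upwards [ae_mem_period] with b hb
    exact integral_conjugate_eq hp hp' hC hh hb
  have vG := iG.hasIntegralValue
  rw [e1]
  set V := ∫ z : ℝ × ℝ, (p (Real.tan z.1) - p (Real.tan z.2)) ^ 2 *
      (cutWeight h z.1 / Real.sin (z.2 - z.1) ^ 2
        + cutWeightDeriv h z.1 * (Real.cos (z.2 - z.1) / Real.sin (z.2 - z.1)))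
      ∂(angleMeasure.prod angleMeasure)
  have vS := (vG.add vG.prod_swap).const_mul (1 / 2)
  have hPm : Measurable fun a => p (Real.tan a) := hpm.comp htan
  have hform := form_lower hμ hμ1 hPm (fun x => hC (Real.tan x))
  have iR := integrable_regularised_form hμ hPm (fun x => hC (Real.tan x))
  have one : HasIntegralValue angleMeasure (fun _ => (1 : ℝ)) Real.pi :=
    ⟨integrable_const _, integral_angleMeasure_one⟩
  -- The errors of `kernel_lower` are multiplied by $(P(a)-P(b))^2\le4C^2$; in particular
  -- $32=8\cdot4$.
  have vR := (iR.hasIntegralValue.sub (integral_deficit_prod (μ := μ).const_mul (32 * C ^ 2))).sub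
    ((one.prod_mul one).const_mul (4 * C ^ 2 * (2 * h / μ ^ 2 + 2 * h / μ)))
  have hle := integral_mono_ae vR.1 vS.1 (by
    filter_upwards [ae_mem_period_prod] with z hz
    obtain ⟨x, y⟩ := z
    obtain ⟨hx, hy⟩ := hz
    simp only [Prod.swap_prod_mk] at hx hy ⊢
    have hD : (p (Real.tan x) - p (Real.tan y)) ^ 2 ≤ 4 * C ^ 2 := by
      have h1 := abs_le.1 (hC (Real.tan x)); have h2 := abs_le.1 (hC (Real.tan y))
      nlinarith
    have hD0 := sq_nonneg (p (Real.tan x) - p (Real.tan y))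
    have hf0 := deficit_nonneg (μ := μ) (Real.sin (y - x))
    have hρ : 0 ≤ 2 * h / μ ^ 2 + 2 * h / μ := by positivity
    have hDs : (p (Real.tan y) - p (Real.tan x)) ^ 2 = (p (Real.tan x) - p (Real.tan y)) ^ 2 := by
      ring
    rw [hDs]
    -- On the diagonal the squared difference vanishes, so the value assigned to the singular kernel
    -- is immaterial.
    rcases eq_or_ne x y with rfl | hxy
    · simp only [sub_self, ne_eq, OfNat.ofNat_ne_zero, not_false_eq_true, zero_pow, zero_mul,
        add_zero, mul_zero, zero_sub]
      have h1 : 0 ≤ 32 * C ^ 2 * (μ ^ 2 / (Real.sin 0 ^ 2 + μ ^ 2)) := by positivity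
      have h2 : 0 ≤ 4 * C ^ 2 * (2 * h / μ ^ 2 + 2 * h / μ) * (1 * 1) := by positivity
      simp only [Real.sin_zero, ne_eq, OfNat.ofNat_ne_zero, not_false_eq_true, zero_pow] at h1 ⊢
      linarith
    · have hk := kernel_lower hμ hh.le (cos_nonneg_of_mem_period hx) (cos_nonneg_of_mem_period hy)
        (sin_sub_ne_zero_of_mem_period hx hy hxy)
      have hm := mul_le_mul_of_nonneg_left hk hD0
      have m1 := mul_le_mul_of_nonneg_right hD hf0
      have m2 := mul_le_mul_of_nonneg_right hD hρ
      linarith)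
  rw [vR.2, vS.2] at hle
  linarith
end profile

/-! ### The dilation pairing and the drift inequality -/

theorem tendsto_kernelDeficit : Tendsto kernelDeficit (𝓝[>] 0) (𝓝 0) := by
  have h := tendsto_integral_filter_of_dominated_convergence (μ := angleMeasure)
    (l := 𝓝[>] (0 : ℝ)) (F := fun μ a => μ ^ 2 / (Real.sin a ^ 2 + μ ^ 2)) (f := fun _ => (0 : ℝ))
    (fun _ => 1) (Eventually.of_forall fun μ =>
      (by fun_prop : Measurable fun a => μ ^ 2 / (Real.sin a ^ 2 + μ ^ 2)).aestronglyMeasurable)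
    (Eventually.of_forall fun μ => Eventually.of_forall fun a => by
      rw [Real.norm_eq_abs, abs_of_nonneg (deficit_nonneg _)]; exact deficit_le_one _)
    (integrable_const _) ?_
  · rw [integral_zero] at h
    exact h
  · have h0 : ∀ᵐ a ∂angleMeasure, a ≠ 0 :=
      ae_restrict_of_ae (compl_mem_ae_iff.2 (by simp : volume ({0} : Set ℝ) = 0))
    filter_upwards [ae_mem_period, h0] with a ha ha0
    have hs : Real.sin a ≠ 0 := by
      have := sin_sub_ne_zero_of_mem_period (a := 0) (b := a)
        ⟨by linarith [Real.pi_pos], by linarith [Real.pi_pos]⟩ ha (Ne.symm ha0)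
      simpa using this
    have hc : ContinuousAt (fun μ : ℝ => μ ^ 2 / (Real.sin a ^ 2 + μ ^ 2)) 0 :=
      ContinuousAt.div (by fun_prop) (by fun_prop) (by simpa using hs)
    have := hc.tendsto.mono_left (nhdsWithin_le_nhds (s := Ioi 0))
    simpa using this

theorem integral_deficit_cos {h : ℝ} :
    ∫ a, h ^ 2 / (Real.cos a ^ 2 + h ^ 2) ∂angleMeasure = kernelDeficit h := by
  rw [← integral_deficit_sub (Real.pi / 2)]
  simp [Real.sin_sub_pi_div_two]

/-- For the exact weight $\cos^2$ one has $\cos^2a\tan a=\frac12\sin2a$, with derivative $\cos2a$.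
The lemma measures how far truncation disturbs this; where $\cos a\le h$ the deficit is at least
$1/2$ and pays for everything. -/
theorem abs_weighted_tan_deriv_sub_le {h a : ℝ} (hh : 0 < h) (ha : 0 ≤ Real.cos a) :
    |cutWeightDeriv h a * Real.tan a + cutWeight h a * (1 / Real.cos a ^ 2) - Real.cos (2 * a)|
      ≤ 2 * h + 2 * (h ^ 2 / (Real.cos a ^ 2 + h ^ 2)) := by
  have hden : 0 < Real.cos a ^ 2 + h ^ 2 := by positivity
  rcases le_total (Real.cos a) h with hc | hc
  · rw [cutWeight_of_cos_le hc, cutWeightDeriv_of_cos_le hc]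
    simp only [zero_mul, zero_add, zero_sub, abs_neg]
    have h1 : 1 / 2 ≤ h ^ 2 / (Real.cos a ^ 2 + h ^ 2) := by
      rw [div_le_div_iff₀ (by norm_num) hden]
      nlinarith
    linarith [Real.abs_cos_le_one (2 * a)]
  · have hc0 : 0 < Real.cos a := hh.trans_le hc
    have e : cutWeightDeriv h a * Real.tan a + cutWeight h a * (1 / Real.cos a ^ 2)
        - Real.cos (2 * a) = -(2 * h * Real.cos a) + h ^ 2 / Real.cos a ^ 2 := by
      rw [cutWeightDeriv, cutWeight, max_eq_left (by linarith), Real.tan_eq_sin_div_cos,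
        Real.cos_two_mul]
      have hs : Real.sin a ^ 2 = 1 - Real.cos a ^ 2 := by
        linarith [Real.sin_sq_add_cos_sq a]
      field_simp
      rw [hs]; ring
    have h1 : h ^ 2 / Real.cos a ^ 2 ≤ 2 * (h ^ 2 / (Real.cos a ^ 2 + h ^ 2)) := by
      rw [← mul_div_assoc, div_le_div_iff₀ (by positivity) hden]
      have h2 : h ^ 2 ≤ Real.cos a ^ 2 := pow_le_pow_left₀ hh.le hc 2
      nlinarith [mul_le_mul_of_nonneg_left h2 (sq_nonneg h)]
    have h2 : 0 ≤ h ^ 2 / Real.cos a ^ 2 := by positivity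
    have h3 : 0 ≤ h * Real.cos a := by positivity
    have h4 : h * Real.cos a ≤ h := by nlinarith [Real.cos_le_one a]
    rw [e, abs_le]
    constructor <;> linarith

section profile
variable {p p' : ℝ → ℝ} {C h : ℝ}

/-- Integration by parts against `cutWeight h a * tan a`, whose derivative is nearly $\cos 2a$. It
ties the pairing created by rescaling to the quantity that the quadratic form controls. -/
theorem abs_dilation_pairing_add_le (hp : ∀ x, HasDerivAt p (p' x) x) (hp' : Continuous p')
    (hC : ∀ x, |p x| ≤ C) (hh : 0 < h) :
    |(∫ a, cutWeight h a * (p' (Real.tan a) * (1 / Real.cos a ^ 2)) * Real.tan a ∂angleMeasure)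
        + ∫ a, p (Real.tan a) * Real.cos (2 * a) ∂angleMeasure|
      ≤ C * (2 * Real.pi * h + 2 * kernelDeficit h) := by
  have hpi := Real.pi_pos
  have hC0 : 0 ≤ C := (abs_nonneg _).trans (hC 0)
  have hpm : Measurable p :=
    (continuous_iff_continuousAt.2 fun x => (hp x).continuousAt).measurable
  have hp'm := hp'.measurable
  have htan := measurable_real_tan
  have hw := measurable_cutWeight (h := h)
  have hw' := measurable_cutWeightDeriv (h := h)
  obtain ⟨K₂, hK₂, hB⟩ := exists_bound_cutWeight_mul hp' hh
  have one : HasIntegralValue angleMeasure (fun _ => (1 : ℝ)) Real.pi :=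
    ⟨integrable_const _, integral_angleMeasure_one⟩
  have iF : Integrable (fun a => cutWeight h a * (p' (Real.tan a) * (1 / Real.cos a ^ 2))
      * Real.tan a) angleMeasure := by
    refine Integrable.of_bound (by fun_prop) (K₂ * (1 / h)) ?_
    filter_upwards [ae_mem_period] with a ha
    rcases le_total (Real.cos a) h with hc | hc
    · rw [cutWeight_of_cos_le hc]; simp; positivity
    · rw [Real.norm_eq_abs, abs_mul]
      exact mul_le_mul (hB a (cos_nonneg_of_mem_period ha)) (abs_tan_le_of_le_cos hh hc)
        (abs_nonneg _) hK₂
  have iP : Integrable (fun a => p (Real.tan a) * Real.cos (2 * a)) angleMeasure := by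
    refine Measurable.integrable_of_abs_le (by fun_prop) (C * 1) fun a => ?_
    rw [abs_mul]
    exact mul_le_mul (hC _) (Real.abs_cos_le_one _) (abs_nonneg _) hC0
  have vdef : HasIntegralValue angleMeasure (fun a => h ^ 2 / (Real.cos a ^ 2 + h ^ 2))
      (kernelDeficit h) := by
    refine ⟨?_, integral_deficit_cos⟩
    refine Measurable.integrable_of_abs_le (by fun_prop) 1 fun a => ?_
    rw [abs_of_nonneg (deficit_nonneg _)]; exact deficit_le_one _
  have vbound := ((one.const_mul (2 * h)).add (vdef.const_mul 2)).const_mul C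
  have hbound : ∀ᵐ a ∂angleMeasure, ‖(cutWeightDeriv h a * Real.tan a
      + cutWeight h a * (1 / Real.cos a ^ 2) - Real.cos (2 * a)) * p (Real.tan a)‖
      ≤ C * (2 * h * 1 + 2 * (h ^ 2 / (Real.cos a ^ 2 + h ^ 2))) := by
    filter_upwards [ae_mem_period] with a ha
    rw [Real.norm_eq_abs, abs_mul, mul_comm, mul_one]
    exact mul_le_mul (hC _) (abs_weighted_tan_deriv_sub_le hh (cos_nonneg_of_mem_period ha))
      (abs_nonneg _) hC0
  have iE : Integrable (fun a => (cutWeightDeriv h a * Real.tan a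
      + cutWeight h a * (1 / Real.cos a ^ 2) - Real.cos (2 * a)) * p (Real.tan a))
      angleMeasure := Integrable.mono' vbound.1 (by fun_prop) hbound
  have hE := norm_integral_le_of_norm_le vbound.1 hbound
  rw [vbound.2, Real.norm_eq_abs] at hE
  have key := (iF.hasIntegralValue.add iP.hasIntegralValue).add iE.hasIntegralValue
  set ψ : ℝ → ℝ := fun a => cutWeight h a * (Real.tan a * p (Real.tan a)) with hψ
  have hψ0 : ∀ x, Real.cos x = 0 → ψ =ᶠ[𝓝 x] 0 := by
    intro x hx
    filter_upwards [cutWeight_eventuallyEq_zero (h := h) (a := x) (by rw [hx]; exact hh)]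
      with y hy
    simp only [hψ, hy, Pi.zero_apply, zero_mul]
  have hder : ∀ x ∈ Ioo (-(Real.pi / 2)) (Real.pi / 2) \ ∅, HasDerivAt ψ
      (cutWeight h x * (p' (Real.tan x) * (1 / Real.cos x ^ 2)) * Real.tan x
        + p (Real.tan x) * Real.cos (2 * x)
        + (cutWeightDeriv h x * Real.tan x + cutWeight h x * (1 / Real.cos x ^ 2)
          - Real.cos (2 * x)) * p (Real.tan x)) x := by
    rintro x ⟨hx, -⟩
    have hcx : Real.cos x ≠ 0 := (Real.cos_pos_of_mem_Ioo hx).ne'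
    have d := (hasDerivAt_cutWeight (h := h) x).mul
      ((Real.hasDerivAt_tan hcx).mul (hasDerivAt_comp_tan hp hcx))
    refine d.congr_deriv ?_
    simp only [Pi.mul_apply]
    ring
  have hcont : ContinuousOn ψ (Icc (-(Real.pi / 2)) (Real.pi / 2)) := by
    intro x hx
    refine ContinuousAt.continuousWithinAt ?_
    by_cases hc : Real.cos x = 0
    · exact (continuousAt_const (y := (0 : ℝ))).congr (hψ0 x hc).symm
    · refine (hder x ⟨⟨lt_of_le_of_ne hx.1 fun he => hc ?_, lt_of_le_of_ne hx.2 fun he => hc ?_⟩,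
        notMem_empty _⟩).continuousAt
      · rw [← he, Real.cos_neg, Real.cos_pi_div_two]
      · rw [he, Real.cos_pi_div_two]
  have hFTC := integral_eq_of_hasDerivAt_off_countable_of_le ψ _
    (by linarith : -(Real.pi / 2) ≤ Real.pi / 2) countable_empty hcont hder
    ((intervalIntegrable_iff_integrableOn_Ioc_of_le (by linarith)).2 key.1)
  rw [← integral_angleMeasure, key.2, (hψ0 _ Real.cos_pi_div_two).self_of_nhds,
    (hψ0 _ (by rw [Real.cos_neg, Real.cos_pi_div_two])).self_of_nhds] at hFTC
  simp only [Pi.zero_apply, sub_self] at hFTC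
  have e : (∫ a, cutWeight h a * (p' (Real.tan a) * (1 / Real.cos a ^ 2)) * Real.tan a
        ∂angleMeasure) + ∫ a, p (Real.tan a) * Real.cos (2 * a) ∂angleMeasure
      = -∫ a, (cutWeightDeriv h a * Real.tan a + cutWeight h a * (1 / Real.cos a ^ 2)
          - Real.cos (2 * a)) * p (Real.tan a) ∂angleMeasure := by linarith
  rw [e, abs_neg]
  linarith

end profile

/-- The drift term tested against the truncated Poisson kernel dominates the square of the
dilation term, up to an error `η C²`. -/
def DriftLowerBound (h η : ℝ) : Prop :=
  ∀ (p p' V : ℝ → ℝ) (C c : ℝ),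
    (∀ x, HasDerivAt p (p' x) x) → Continuous p' → (∀ x, |p x| ≤ C) →
    (∀ a ∈ Ioo (-(Real.pi / 2)) (Real.pi / 2), V a = c + (1 / Real.pi) *
      ∫ b, (p (Real.tan b) - p (Real.tan a)) * (Real.cos (b - a) / Real.sin (b - a))
        ∂angleMeasure) →
    ∫ a, cutWeight h a * (p' (Real.tan a) * (1 / Real.cos a ^ 2)) ∂angleMeasure = 0 →
    (1 / (16 * Real.pi)) * (∫ a, cutWeight h a * (p' (Real.tan a) * (1 / Real.cos a ^ 2))
        * Real.tan a ∂angleMeasure) ^ 2 - η * C ^ 2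
      ≤ ∫ a, cutWeight h a * (p' (Real.tan a) * (1 / Real.cos a ^ 2)) * V a ∂angleMeasure

/-- The parameter $\mu$ is fixed first, to make its deficit small; then $h$ is taken small compared
with $\mu$, because the truncation error contains $h/\mu^2$. Neither choice depends on the profile.
-/
theorem exists_driftLowerBound {η : ℝ} (hη : 0 < η) :
    ∃ h : ℝ, 0 < h ∧ h ≤ 1 / 4 ∧ DriftLowerBound h η := by
  have hpi := Real.pi_pos
  have hpi1 : 1 ≤ Real.pi := by linarith [Real.pi_gt_three]
  have hid : Tendsto (fun x : ℝ => x) (𝓝[>] 0) (𝓝 0) := tendsto_id.mono_left nhdsWithin_le_nhds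
  have t1 : Tendsto (fun μ => 20 * Real.pi * kernelDeficit μ) (𝓝[>] 0) (𝓝 0) := by
    simpa using tendsto_kernelDeficit.const_mul (20 * Real.pi)
  obtain ⟨μ, ⟨hμe, hμ1⟩, hμ⟩ := ((t1.eventually (gt_mem_nhds (by positivity : (0 : ℝ) < η / 3))).and
    (hid.eventually (gt_mem_nhds (by norm_num : (0 : ℝ) < 1))) |>.and self_mem_nhdsWithin).exists
  have hμ : 0 < μ := hμ
  have t2 : Tendsto (fun h : ℝ => 2 * Real.pi ^ 2 * (2 * h / μ ^ 2 + 2 * h / μ))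
      (𝓝[>] 0) (𝓝 0) := by
    have : Continuous fun h : ℝ => 2 * Real.pi ^ 2 * (2 * h / μ ^ 2 + 2 * h / μ) := by fun_prop
    have := (this.tendsto 0).mono_left (nhdsWithin_le_nhds (s := Ioi 0))
    simpa using this
  have t3 : Tendsto (fun h : ℝ => (1 / 8) * (2 * Real.pi * h + 2 * kernelDeficit h) ^ 2)
      (𝓝[>] 0) (𝓝 0) := by
    have := (((hid.const_mul (2 * Real.pi)).add
      (tendsto_kernelDeficit.const_mul 2)).pow 2).const_mul (1 / 8)
    rwa [mul_zero, mul_zero, add_zero, zero_pow two_ne_zero, mul_zero] at this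
  obtain ⟨h, ⟨⟨h2, h3⟩, h4⟩, hh⟩ := (((t2.eventually (gt_mem_nhds (by positivity : 0 < η / 3))).and
    (t3.eventually (gt_mem_nhds (by positivity : 0 < η / 3)))).and
    (hid.eventually (gt_mem_nhds (by norm_num : (0 : ℝ) < 1 / 4)))
      |>.and self_mem_nhdsWithin).exists
  have hh : 0 < h := hh
  refine ⟨h, hh, h4.le, fun p p' V C c hp hp' hC hV h0 => ?_⟩
  obtain ⟨hint, hlow⟩ := conjugate_pairing_lower hp hp' hC hh hμ hμ1.le
  have hdil := abs_dilation_pairing_add_le hp hp' hC hh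
  obtain ⟨K₂, hK₂, hB⟩ := exists_bound_cutWeight_mul hp' hh
  have hp'm := hp'.measurable
  have htan := measurable_real_tan
  have hw := measurable_cutWeight (h := h)
  have iw : Integrable (fun a => cutWeight h a * (p' (Real.tan a) * (1 / Real.cos a ^ 2)))
      angleMeasure := by
    refine Integrable.of_bound (by fun_prop) K₂ ?_
    filter_upwards [ae_mem_period] with a ha
    exact hB a (cos_nonneg_of_mem_period ha)
  have vV := (iw.hasIntegralValue.const_mul c).add (hint.hasIntegralValue.const_mul (1 / Real.pi))
  have e : ∫ a, cutWeight h a * (p' (Real.tan a) * (1 / Real.cos a ^ 2)) * V a ∂angleMeasure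
      = ∫ a, (c * (cutWeight h a * (p' (Real.tan a) * (1 / Real.cos a ^ 2))) + (1 / Real.pi) *
        (cutWeight h a * (p' (Real.tan a) * (1 / Real.cos a ^ 2)) *
          ∫ b, (p (Real.tan b) - p (Real.tan a)) * (Real.cos (b - a) / Real.sin (b - a))
          ∂angleMeasure)) ∂angleMeasure := by
    refine integral_congr_ae ?_
    filter_upwards [ae_mem_period] with a ha
    -- The right endpoint belongs to the half period but not to the range of the formula for `V`;
    -- the weight vanishes there.
    rcases eq_or_lt_of_le ha.2 with hae | hae
    · rw [cutWeight_of_cos_le (by rw [hae, Real.cos_pi_div_two]; exact hh.le)]; simp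
    · rw [hV a ⟨ha.1, hae⟩]; ring
  rw [e, vV.2, h0, mul_zero, zero_add]
  set L := ∫ a, cutWeight h a * (p' (Real.tan a) * (1 / Real.cos a ^ 2)) * Real.tan a ∂angleMeasure
  set A := ∫ a, p (Real.tan a) * Real.cos (2 * a) ∂angleMeasure
  set N := ∫ a, cutWeight h a * (p' (Real.tan a) * (1 / Real.cos a ^ 2)) *
        (∫ b, (p (Real.tan b) - p (Real.tan a)) * (Real.cos (b - a) / Real.sin (b - a))
          ∂angleMeasure) ∂angleMeasure
  have hsq : (L + A) ^ 2 ≤ C ^ 2 * (2 * Real.pi * h + 2 * kernelDeficit h) ^ 2 := by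
    rw [← mul_pow]
    exact sq_le_sq' (abs_le.1 hdil).1 (abs_le.1 hdil).2
  have hC2 : 0 ≤ C ^ 2 := sq_nonneg C
  have m1 := mul_le_mul_of_nonneg_left hμe.le hC2
  have m2 := mul_le_mul_of_nonneg_left h2.le hC2
  have m3 := mul_le_mul_of_nonneg_left h3.le hC2
  -- From $L^2\le2A^2+2(L+A)^2$, where $L+A$ is the small dilation error; each of the three errors
  -- takes $\eta/3$.
  have hN : (1 / 16) * L ^ 2 - η * C ^ 2 ≤ N := by
    nlinarith [sq_nonneg (L + 2 * A)]
  have hN2 := mul_le_mul_of_nonneg_left hN (by positivity : 0 ≤ 1 / Real.pi)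
  have e2 : 1 / (16 * Real.pi) = 1 / Real.pi * (1 / 16) := by field_simp
  have e3 : 1 / Real.pi * (η * C ^ 2) ≤ 1 * (η * C ^ 2) := by
    refine mul_le_mul_of_nonneg_right ?_ (by positivity)
    rw [div_le_one hpi]; exact hpi1
  rw [e2]
  linarith

/-! ### The Hilbert transform in the angular variable -/

section hilbert
variable {f f' : ℝ → ℝ} {C : ℝ}

theorem exists_bound_difference_quotient (hf : ∀ x, HasDerivAt f (f' x) x) (hf' : Continuous f')
    (hC : ∀ x, |f x| ≤ C) (x : ℝ) : ∃ B : ℝ, 0 ≤ B ∧ ∀ z, |(f z - f x) / (z - x)| ≤ B := by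
  have hC0 : 0 ≤ C := (abs_nonneg _).trans (hC 0)
  obtain ⟨K, hK⟩ := (isCompact_Icc (a := x - 1) (b := x + 1)).exists_bound_of_continuousOn
    hf'.continuousOn
  have hK0 : 0 ≤ K := (norm_nonneg _).trans (hK x ⟨by linarith, by linarith⟩)
  refine ⟨K + 2 * C, by positivity, fun z => ?_⟩
  rcases le_total (|z - x|) 1 with hz | hz
  · have h1 := (convex_Icc (x - 1) (x + 1)).norm_image_sub_le_of_norm_hasDerivWithin_le
      (fun y _ => (hf y).hasDerivWithinAt) hK (x := x) (y := z) ⟨by linarith, by linarith⟩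
      ⟨by linarith [(abs_le.1 hz).1], by linarith [(abs_le.1 hz).2]⟩
    rw [Real.norm_eq_abs, Real.norm_eq_abs] at h1
    rw [abs_div]
    exact (div_le_of_le_mul₀ (abs_nonneg _) hK0 h1).trans (by linarith)
  · have h3 : |f z - f x| ≤ 2 * C := by
      have := abs_le.1 (hC z); have := abs_le.1 (hC x)
      rw [abs_le]; constructor <;> linarith
    rw [abs_div]
    exact (div_le_self (abs_nonneg _) hz).trans (by linarith)

/-- For bounded `C¹` functions the principal value can be written with the difference quotient. -/
theorem HasHilbertTransformAt.tendsto_integral_quotient {x v : ℝ}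
    (hv : HasHilbertTransformAt f x v) (hf : ∀ x, HasDerivAt f (f' x) x) (hf' : Continuous f')
    (hC : ∀ x, |f x| ≤ C) :
    Tendsto (fun R : ℝ => ∫ z in (x - R)..(x + R), (f z - f x) / (z - x)) atTop
      (𝓝 (Real.pi * v)) := by
  obtain ⟨B, hB0, hB⟩ := exists_bound_difference_quotient hf hf' hC x
  have hfm : Measurable f := (continuous_iff_continuousAt.2 fun x => (hf x).continuousAt).measurable
  have hS : ∀ δ : ℝ, MeasurableSet {y : ℝ | δ < |y - x| ∧ |y - x| < δ⁻¹} := by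
    intro δ
    have h1 : MeasurableSet {y : ℝ | δ < |y - x|} := measurableSet_lt (by fun_prop) (by fun_prop)
    have h2 : MeasurableSet {y : ℝ | |y - x| < δ⁻¹} := measurableSet_lt (by fun_prop) (by fun_prop)
    exact h1.inter h2
  -- Reflection about $x$: subtracting $f(x)$ in the numerator does not change the truncated
  -- integrals.
  have hodd : ∀ δ : ℝ, ∫ y in {y : ℝ | δ < |y - x| ∧ |y - x| < δ⁻¹}, (f x) * (1 / (y - x)) = 0 := by
    intro δ
    rw [← integral_indicator (hS δ)]
    set F := indicator {y : ℝ | δ < |y - x| ∧ |y - x| < δ⁻¹} fun y => (f x) * (1 / (y - x)) with hF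
    have h1 : ∫ y, F (2 * x - y) = ∫ y, F y := integral_sub_left_eq_self F volume (2 * x)
    have h2 : ∀ y, F (2 * x - y) = -F y := by
      intro y
      have e : 2 * x - y - x = -(y - x) := by ring
      simp only [hF, indicator, mem_ofPred_eq, e, abs_neg]
      split_ifs
      · rw [div_neg]; ring
      · simp
    simp_rw [h2, integral_neg] at h1
    linarith
  have hqint : ∀ s : Set ℝ, volume s ≠ ⊤ → IntegrableOn (fun z => (f z - f x) / (z - x)) s :=
    fun s hs => Measure.integrableOn_of_bounded hs
      (by fun_prop : Measurable fun z => (f z - f x) / (z - x)).aestronglyMeasurable (M := B)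
      (Eventually.of_forall fun z => hB z)
  have hsub : ∀ δ : ℝ, {y : ℝ | δ < |y - x| ∧ |y - x| < δ⁻¹} ⊆ Ioc (x - δ⁻¹) (x + δ⁻¹) := by
    rintro δ y ⟨-, hy⟩
    rw [abs_lt] at hy
    exact ⟨by linarith [hy.1], by linarith [hy.2]⟩
  have hpv : ∀ δ : ℝ, 0 < δ →
      ∫ y in {y : ℝ | δ < |y - x| ∧ |y - x| < δ⁻¹}, f y / (y - x)
        = ∫ y in {y : ℝ | δ < |y - x| ∧ |y - x| < δ⁻¹}, (f y - f x) / (y - x) := by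
    intro δ hδ
    have hfin : volume {y : ℝ | δ < |y - x| ∧ |y - x| < δ⁻¹} ≠ ⊤ :=
      ((measure_mono (hsub δ)).trans_lt measure_Ioc_lt_top).ne
    have i2 : IntegrableOn (fun y => (f x) * (1 / (y - x)))
        {y : ℝ | δ < |y - x| ∧ |y - x| < δ⁻¹} := by
      refine Measure.integrableOn_of_bounded hfin
        (by fun_prop : Measurable fun y => (f x) * (1 / (y - x))).aestronglyMeasurable
        (M := C * (1 / δ)) ?_
      filter_upwards [ae_restrict_mem (hS δ)] with y hy
      rw [Real.norm_eq_abs, abs_mul, abs_div, abs_one]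
      exact mul_le_mul (hC x) (one_div_le_one_div_of_le hδ hy.1.le) (by positivity)
        ((abs_nonneg _).trans (hC 0))
    have := integral_add (hqint _ hfin) i2
    rw [hodd, add_zero] at this
    rw [← this]
    congr 1; ext y; ring
  have hcmp : ∀ δ : ℝ, 0 < δ → |(∫ z in (x - δ⁻¹)..(x + δ⁻¹), (f z - f x) / (z - x))
      - ∫ y in {y : ℝ | δ < |y - x| ∧ |y - x| < δ⁻¹}, f y / (y - x)| ≤ B * (2 * δ) := by
    intro δ hδ
    have hδi : 0 < δ⁻¹ := inv_pos.2 hδ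
    rw [hpv δ hδ, intervalIntegral.integral_of_le (by linarith),
      ← setIntegral_sdiff (hS δ) (hqint _ measure_Ioc_lt_top.ne) (hsub δ)]
    -- The full interval differs from the truncated set by a central piece of length $2\delta$ and
    -- one endpoint.
    have hss : Ioc (x - δ⁻¹) (x + δ⁻¹) \ {y : ℝ | δ < |y - x| ∧ |y - x| < δ⁻¹}
        ⊆ Icc (x - δ) (x + δ) ∪ {x + δ⁻¹} := by
      rintro y ⟨hy, hn⟩
      rw [mem_ofPred_eq, not_and_or, not_lt, not_lt] at hn
      rcases hn with hn | hn
      · rw [abs_le] at hn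
        exact Or.inl ⟨by linarith [hn.1], by linarith [hn.2]⟩
      · right
        rcases le_abs'.1 hn with h | h
        · linarith [hy.1]
        · exact le_antisymm hy.2 (by linarith)
    have hvol : volume (Icc (x - δ) (x + δ) ∪ {x + δ⁻¹}) ≤ ENNReal.ofReal (2 * δ) := by
      refine (measure_union_le _ _).trans ?_
      rw [Real.volume_Icc, Real.volume_singleton, add_zero]
      exact ENNReal.ofReal_le_ofReal (by linarith)
    have hvol' := (measure_mono hss).trans hvol
    have := norm_setIntegral_le_of_norm_le_const (μ := volume)
      (hvol'.trans_lt ENNReal.ofReal_lt_top) (f := fun z => (f z - f x) / (z - x)) (C := B)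
      (fun z _ => hB z)
    rw [Real.norm_eq_abs] at this
    refine this.trans (mul_le_mul_of_nonneg_left ?_ hB0)
    exact ENNReal.toReal_le_of_le_ofReal (by positivity) hvol'
  have hlim1 : Tendsto (fun δ : ℝ => ∫ y in {y : ℝ | δ < |y - x| ∧ |y - x| < δ⁻¹}, f y / (y - x))
      (𝓝[>] 0) (𝓝 (Real.pi * v)) := by
    have := Tendsto.const_mul Real.pi hv
    refine this.congr fun δ => ?_
    rw [← mul_assoc, mul_one_div_cancel Real.pi_pos.ne', one_mul]
  have hlim2 : Tendsto (fun δ : ℝ => (∫ z in (x - δ⁻¹)..(x + δ⁻¹), (f z - f x) / (z - x))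
      - ∫ y in {y : ℝ | δ < |y - x| ∧ |y - x| < δ⁻¹}, f y / (y - x)) (𝓝[>] 0) (𝓝 0) := by
    refine squeeze_zero_norm' (a := fun δ => B * (2 * δ)) ?_ ?_
    · filter_upwards [self_mem_nhdsWithin] with δ hδ
      exact hcmp δ hδ
    · have : Continuous fun δ : ℝ => B * (2 * δ) := by fun_prop
      simpa using (this.tendsto 0).mono_left (nhdsWithin_le_nhds (s := Ioi 0))
  have hlim3 := (hlim2.add hlim1).comp tendsto_inv_atTop_nhdsGT_zero
  simpa [Function.comp_def] using hlim3

/-- Moving the centre to $y$ changes the interval only by two pieces of length $|y|$ near $\pm R$,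
where the integrand is $O(1/R)$. It allows principal values at different points to be compared over
the same intervals. -/
theorem tendsto_shifted_integral_sub {g : ℝ → ℝ} (hg : Continuous g) {D : ℝ}
    (hD : ∀ z, |g z| * |z| ≤ D) (y : ℝ) :
    Tendsto (fun R : ℝ => (∫ z in (y - R)..(y + R), g z) - ∫ z in (-R)..R, g z) atTop (𝓝 0) := by
  have hD0 : 0 ≤ D := by simpa using hD 0
  refine squeeze_zero_norm' (a := fun R => 2 * (D * |y|) * (R - |y|)⁻¹) ?_ ?_
  · filter_upwards [eventually_gt_atTop |y|] with R hR
    have hpos : 0 < R - |y| := by linarith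
    have hi : ∀ a b : ℝ, IntervalIntegrable g volume a b := fun a b => hg.intervalIntegrable a b
    rw [intervalIntegral.integral_interval_sub_interval_comm (hi _ _) (hi _ _) (hi _ _)]
    have hb : ∀ z, R - |y| ≤ |z| → ‖g z‖ ≤ D * (R - |y|)⁻¹ := by
      intro z hz
      rw [Real.norm_eq_abs, ← div_eq_mul_inv, le_div_iff₀ hpos]
      exact (mul_le_mul_of_nonneg_left hz (abs_nonneg _)).trans (hD z)
    have y1 := neg_abs_le y
    have y2 := le_abs_self y
    have b1 := intervalIntegral.norm_integral_le_of_norm_le_const (a := y - R) (b := -R) (f := g)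
      (C := D * (R - |y|)⁻¹) (fun z hz => hb z (by
        rw [mem_uIoc] at hz
        rw [le_abs']; left
        rcases hz with hz | hz <;> linarith [hz.1, hz.2]))
    have b2 := intervalIntegral.norm_integral_le_of_norm_le_const (a := y + R) (b := R) (f := g)
      (C := D * (R - |y|)⁻¹) (fun z hz => hb z (by
        rw [mem_uIoc] at hz
        rw [le_abs']; right
        rcases hz with hz | hz <;> linarith [hz.1, hz.2]))
    rw [show -R - (y - R) = -y by ring, abs_neg] at b1
    rw [show R - (y + R) = -y by ring, abs_neg] at b2
    refine (norm_sub_le _ _).trans ?_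
    linarith
  · have h1 : Tendsto (fun R : ℝ => R - |y|) atTop atTop :=
      tendsto_atTop_add_const_right _ _ tendsto_id
    simpa using (tendsto_inv_atTop_zero.comp h1).const_mul (2 * (D * |y|))

theorem abs_conjugate_poisson_mul_le (z : ℝ) : |z / (1 + z ^ 2)| * |z| ≤ 1 := by
  rw [abs_div, abs_of_pos (by positivity : 0 < 1 + z ^ 2), div_mul_eq_mul_div,
    div_le_one (by positivity), abs_mul_abs_self]
  nlinarith

/-- The renormalised Hilbert kernel gives the symmetric limits up to a constant. -/
theorem tendsto_integral_conjugate_poisson (hf : ∀ x, HasDerivAt f (f' x) x)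
    (hf' : Continuous f') (hC : ∀ x, |f x| ≤ C) {y w : ℝ}
    (hw : Tendsto (fun R : ℝ => ∫ z in (y - R)..(y + R), (f z - f y) / (z - y)) atTop (𝓝 w)) :
    Tendsto (fun R : ℝ => ∫ z in (-R)..R, f z * (z / (1 + z ^ 2))) atTop
      (𝓝 (w - ∫ z, (f z - f y) * ((z * y + 1) / ((z - y) * (1 + z ^ 2))))) := by
  obtain ⟨B, hB0, hB⟩ := exists_bound_difference_quotient hf hf' hC y
  have hfc : Continuous f := continuous_iff_continuousAt.2 fun x => (hf x).continuousAt
  have hfm := hfc.measurable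
  have hD : ∀ z, |f z - f y| ≤ 2 * C := fun z => by
    have := abs_le.1 (hC z); have := abs_le.1 (hC y)
    rw [abs_le]; constructor <;> linarith
  have hden : ∀ z : ℝ, 1 + z ^ 2 ≠ 0 := fun z => by positivity
  have hk : Integrable fun z => (f z - f y) * ((z * y + 1) / ((z - y) * (1 + z ^ 2))) := by
    refine Integrable.mono' (integrable_inv_one_add_sq.const_mul
      (2 * C * |y| + B * (1 + y ^ 2))) (by fun_prop) (Eventually.of_forall fun z => ?_)
    have e : (f z - f y) * ((z * y + 1) / ((z - y) * (1 + z ^ 2)))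
        = ((f z - f y) * y + (f z - f y) / (z - y) * (1 + y ^ 2)) * (1 + z ^ 2)⁻¹ := by
      rcases eq_or_ne z y with rfl | hz
      · simp
      · have : z - y ≠ 0 := sub_ne_zero.2 hz
        have := hden z
        field_simp
        ring
    rw [e, Real.norm_eq_abs, abs_mul, abs_of_pos (by positivity : 0 < (1 + z ^ 2)⁻¹)]
    refine mul_le_mul_of_nonneg_right ((abs_add_le _ _).trans (add_le_add ?_ ?_)) (by positivity)
    · rw [abs_mul]; exact mul_le_mul_of_nonneg_right (hD z) (abs_nonneg _)
    · rw [abs_mul, abs_of_pos (by positivity : 0 < 1 + y ^ 2)]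
      exact mul_le_mul_of_nonneg_right (hB z) (by positivity)
  have hmc : Continuous fun z : ℝ => z / (1 + z ^ 2) := by fun_prop (disch := exact hden _)
  have hgc : Continuous fun z => (f z - f y) * (z / (1 + z ^ 2)) := by fun_prop
  have l1 := intervalIntegral_tendsto_integral hk
    (tendsto_atBot_add_const_left atTop y tendsto_neg_atTop_atBot)
    (tendsto_atTop_add_const_left atTop y tendsto_id)
  have l2 := tendsto_shifted_integral_sub hgc (D := 2 * C) (fun z => by
    rw [abs_mul, mul_assoc]
    have := mul_le_mul (hD z) (abs_conjugate_poisson_mul_le z) (by positivity)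
      ((abs_nonneg _).trans (hD z))
    linarith) y
  have l3 := (hw.sub l1).sub l2
  rw [sub_zero] at l3
  refine l3.congr fun R => ?_
  -- Splits the kernel as $\frac1{z-y}=\frac{zy+1}{(z-y)(1+z^2)}+\frac z{1+z^2}$: the first term is
  -- integrable against the increment, and the second does not depend on $y$.
  have s1 : ∫ z in (y - R)..(y + R), (f z - f y) / (z - y)
      = (∫ z in (y - R)..(y + R), (f z - f y) * ((z * y + 1) / ((z - y) * (1 + z ^ 2))))
        + ∫ z in (y - R)..(y + R), (f z - f y) * (z / (1 + z ^ 2)) := by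
    rw [← intervalIntegral.integral_add hk.intervalIntegrable (hgc.intervalIntegrable _ _)]
    refine intervalIntegral.integral_congr fun z _ => ?_
    rcases eq_or_ne z y with rfl | hz
    · simp
    · have h1 : z - y ≠ 0 := sub_ne_zero.2 hz
      have := hden z
      field_simp
      ring
  have s2 : ∫ z in (-R)..R, (f z - f y) * (z / (1 + z ^ 2))
      = ∫ z in (-R)..R, f z * (z / (1 + z ^ 2)) := by
    have h0 : ∫ z in (-R)..R, f y * (z / (1 + z ^ 2)) = 0 :=
      integral_odd_eq_zero (fun x => by rw [neg_sq, neg_div]; ring) R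
    have i1 : IntervalIntegrable (fun z => f z * (z / (1 + z ^ 2))) volume (-R) R :=
      (hfc.mul hmc).intervalIntegrable _ _
    have i2 : IntervalIntegrable (fun z => f y * (z / (1 + z ^ 2))) volume (-R) R :=
      (continuous_const.mul hmc).intervalIntegrable _ _
    have := intervalIntegral.integral_sub i1 i2
    rw [h0, sub_zero] at this
    rw [← this]
    refine intervalIntegral.integral_congr fun z _ => ?_
    ring
  simp only [id]
  rw [s1, s2, ← sub_eq_add_neg]
  ring

end hilbert

theorem integral_eq_integral_angleMeasure (g : ℝ → ℝ) :
    ∫ z, g z = ∫ b, (1 / Real.cos b ^ 2) * g (Real.tan b) ∂angleMeasure := by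
  have h := integral_image_eq_integral_abs_deriv_smul (s := Ioo (-(Real.pi / 2)) (Real.pi / 2))
    (f := Real.tan) (f' := fun b => 1 / Real.cos b ^ 2) measurableSet_Ioo
    (fun x hx => (Real.hasDerivAt_tan (Real.cos_pos_of_mem_Ioo hx).ne').hasDerivWithinAt)
    Real.injOn_tan g
  rw [Real.image_tan_Ioo, setIntegral_univ] at h
  rw [h, ← integral_Ioc_eq_integral_Ioo]
  congr 1; ext b
  rw [abs_of_nonneg (by positivity), smul_eq_mul]

/-- The limit of $\int_{-R}^R p(z)\frac{z}{1+z^2}\,dz$, with $p$ the rescaled profile, is the same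
whichever base point is used, so it supplies the constant $c$ (read off at $0$). Under $z=\tan b$
the remaining kernel is $(1+\tan a\tan b)/(\tan b-\tan a)=\cot(b-a)$. -/
theorem exists_hilbert_angle_form {f f' : ℝ → ℝ} {C : ℝ} (hf : ∀ x, HasDerivAt f (f' x) x)
    (hf' : Continuous f') (hC : ∀ x, |f x| ≤ C) {x₀ ε : ℝ} (hε : 0 < ε) {v : ℝ → ℝ}
    (hv : ∀ u, HasHilbertTransformAt f (x₀ + ε * u) (v u)) :
    ∃ c, ∀ a ∈ Ioo (-(Real.pi / 2)) (Real.pi / 2), v (Real.tan a) = c + (1 / Real.pi) *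
      ∫ b, (f (x₀ + ε * Real.tan b) - f (x₀ + ε * Real.tan a)) *
        (Real.cos (b - a) / Real.sin (b - a)) ∂angleMeasure := by
  have hpi := Real.pi_pos
  have hp : ∀ u, HasDerivAt (fun u => f (x₀ + ε * u)) (f' (x₀ + ε * u) * ε) u := by
    intro u
    have d : HasDerivAt (fun u => x₀ + ε * u) ε u := by
      simpa using ((hasDerivAt_id u).const_mul ε).const_add x₀
    exact HasDerivAt.comp (h₂ := f) u (hf _) d
  have hp' : Continuous fun u => f' (x₀ + ε * u) * ε := by fun_prop
  have hq : ∀ y, Tendsto (fun R : ℝ => ∫ u in (y - R)..(y + R),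
      (f (x₀ + ε * u) - f (x₀ + ε * y)) / (u - y)) atTop (𝓝 (Real.pi * v y)) := by
    intro y
    have h1 := ((hv y).tendsto_integral_quotient hf hf' hC).comp
      (tendsto_id.const_mul_atTop hε)
    refine h1.congr fun R => ?_
    have h2 := intervalIntegral.mul_integral_comp_add_mul (a := y - R) (b := y + R)
      (f := fun z => (f z - f (x₀ + ε * y)) / (z - (x₀ + ε * y))) ε x₀
    simp only [Function.comp_apply, id]
    rw [show x₀ + ε * y - ε * R = x₀ + ε * (y - R) by ring,
      show x₀ + ε * y + ε * R = x₀ + ε * (y + R) by ring, ← h2,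
      ← intervalIntegral.integral_const_mul]
    refine intervalIntegral.integral_congr fun u _ => ?_
    rw [show x₀ + ε * u - (x₀ + ε * y) = ε * (u - y) by ring]
    rcases eq_or_ne u y with rfl | huy
    · simp
    · have := sub_ne_zero.2 huy
      field_simp
  have hT := fun y => tendsto_integral_conjugate_poisson hp hp' (fun u => hC _) (hq y)
  refine ⟨(1 / Real.pi) * (Real.pi * v 0 - ∫ z, (f (x₀ + ε * z) - f (x₀ + ε * 0)) *
    ((z * 0 + 1) / ((z - 0) * (1 + z ^ 2)))), fun a ha => ?_⟩
  have huniq := tendsto_nhds_unique (hT (Real.tan a)) (hT 0)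
  rw [← huniq]
  have hJ : ∫ z, (f (x₀ + ε * z) - f (x₀ + ε * Real.tan a)) *
      ((z * Real.tan a + 1) / ((z - Real.tan a) * (1 + z ^ 2)))
      = ∫ b, (f (x₀ + ε * Real.tan b) - f (x₀ + ε * Real.tan a)) *
        (Real.cos (b - a) / Real.sin (b - a)) ∂angleMeasure := by
    rw [integral_eq_integral_angleMeasure]
    have hne : ∀ᵐ b ∂angleMeasure, b ≠ Real.pi / 2 :=
      ae_restrict_of_ae (compl_mem_ae_iff.2 (by simp : volume ({Real.pi / 2} : Set ℝ) = 0))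
    refine integral_congr_ae ?_
    filter_upwards [ae_mem_period, hne] with b hb hb2
    have hcb : 0 < Real.cos b := Real.cos_pos_of_mem_Ioo ⟨hb.1, lt_of_le_of_ne hb.2 hb2⟩
    have hca : 0 < Real.cos a := Real.cos_pos_of_mem_Ioo ha
    rcases eq_or_ne a b with rfl | hab
    · simp
    · have hs := sin_sub_ne_zero_of_mem_period ⟨ha.1, ha.2.le⟩ hb hab
      have e1 : Real.tan b - Real.tan a = Real.sin (b - a) / (Real.cos b * Real.cos a) := by
        rw [Real.tan_eq_sin_div_cos, Real.tan_eq_sin_div_cos, Real.sin_sub]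
        field_simp
      have e2 : Real.tan b * Real.tan a + 1 = Real.cos (b - a) / (Real.cos b * Real.cos a) := by
        rw [Real.tan_eq_sin_div_cos, Real.tan_eq_sin_div_cos, Real.cos_sub]
        field_simp
        ring
      have e3 : 1 + Real.tan b ^ 2 = 1 / Real.cos b ^ 2 := by
        rw [Real.tan_eq_sin_div_cos]
        field_simp
        linarith [Real.sin_sq_add_cos_sq b]
      rw [e1, e2, e3]
      field_simp
  rw [hJ]
  field_simp
  ring

/-! ### A maximum principle -/

/-- A maximum principle: if the time derivative is at most `D` at every spatial maximum point,
then the spatial maximum grows at rate at most `D`. -/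
theorem le_add_mul_of_deriv_le_at_max {W : ℝ → ℝ → ℝ} {T m D : ℝ} (hT : 0 < T)
    (hD : 0 ≤ D) (hcont : ContinuousOn (fun q : ℝ × ℝ => W q.1 q.2) (Icc 0 T ×ˢ univ))
    (hdecay : ∃ R, ∀ t ∈ Icc 0 T, ∀ x, R ≤ |x| → W t x < m) (h0 : ∀ x, W 0 x ≤ m)
    (hder : ∀ t ∈ Ioc 0 T, ∀ x, (∀ y, W t y ≤ W t x) →
      ∃ d ≤ D, HasDerivAt (fun s => W s x) d t) (x : ℝ) :
    W T x ≤ m + D * T := by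
  by_contra! hlt
  obtain ⟨R, hR⟩ := hdecay
  -- Half of the supposed excess, spread over time: after subtracting $(D+\eta)t$ the maximum still
  -- exceeds $m$, so it is not at time $0$ and is a global spatial maximum.
  set η := (W T x - (m + D * T)) / (2 * T) with hη
  have hη0 : 0 < η := div_pos (by linarith) (by linarith)
  have hηT : η * T = (W T x - (m + D * T)) / 2 := by rw [hη]; field_simp
  set R' := max R |x|
  have hcomp : IsCompact (Icc (0 : ℝ) T ×ˢ Icc (-R') R') := isCompact_Icc.prod isCompact_Icc
  have hx : x ∈ Icc (-R') R' := abs_le.1 (le_max_right _ _)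
  obtain ⟨⟨t, z⟩, ⟨ht, hz⟩, hmax⟩ := hcomp.exists_isMaxOn
    ⟨(T, x), ⟨hT.le, le_rfl⟩, hx⟩
    (f := fun q : ℝ × ℝ => W q.1 q.2 - (D + η) * q.1)
    ((hcont.mono (prod_mono le_rfl (subset_univ _))).sub (by fun_prop))
  have hmax' : ∀ s ∈ Icc 0 T, ∀ y ∈ Icc (-R') R',
      W s y - (D + η) * s ≤ W t z - (D + η) * t := fun s hs y hy =>
    isMaxOn_iff.1 hmax (s, y) ⟨hs, hy⟩
  simp only at ht hz
  have hbig : m + (D + η) * t < W t z := by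
    have := hmax' T ⟨hT.le, le_rfl⟩ x hx
    linarith
  have ht0 : 0 < t := by
    rcases eq_or_lt_of_le ht.1 with h | h
    · rw [← h] at hbig
      linarith [h0 z]
    · exact h
  have hglob : ∀ y, W t y ≤ W t z := by
    intro y
    by_cases hy : y ∈ Icc (-R') R'
    · linarith [hmax' t ht y hy]
    · have hy' : R ≤ |y| := by
        by_contra! h
        exact hy (abs_le.1 (h.le.trans (le_max_left _ _)))
      have h1 := hR t ht y hy'
      have h2 : 0 ≤ (D + η) * t := by positivity
      linarith
  obtain ⟨d, hd, hderiv⟩ := hder t ⟨ht0, ht.2⟩ z hglob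
  -- Only slopes from the left are used, because the maximum may sit at the final time.
  have hslope := (hasDerivWithinAt_iff_tendsto_slope' (notMem_Iio.2 le_rfl)).1
    (hderiv.hasDerivWithinAt (s := Iio t))
  have hge : D + η ≤ d := by
    refine ge_of_tendsto hslope ?_
    have : ∀ᶠ s in 𝓝[<] t, 0 < s := (lt_mem_nhds ht0).filter_mono nhdsWithin_le_nhds
    filter_upwards [this, self_mem_nhdsWithin] with s hs0 hst
    have hst : s < t := hst
    rw [slope_def_field, le_div_iff_of_neg (by linarith)]
    have := hmax' s ⟨hs0.le, hst.le.trans ht.2⟩ z hz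
    linarith
  linarith

/-! ### Truncated Poisson averages -/

/-- Weighted averages over the truncated Poisson kernel in the angular variable. -/
noncomputable def cutAverage (h : ℝ) (g : ℝ → ℝ) : ℝ :=
  ∫ a, cutWeight h a * (1 / Real.cos a ^ 2) * g (Real.tan a) ∂angleMeasure

section cutAverage
variable {h : ℝ}

theorem measurable_cutRatio : Measurable fun a => cutWeight h a * (1 / Real.cos a ^ 2) := by
  have := measurable_cutWeight (h := h)
  fun_prop

theorem cutRatio_nonneg (a : ℝ) : 0 ≤ cutWeight h a * (1 / Real.cos a ^ 2) :=
  mul_nonneg (cutWeight_nonneg a) (by positivity)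

theorem cutRatio_le_one (hh : 0 < h) {a : ℝ} (ha : 0 ≤ Real.cos a) :
    cutWeight h a * (1 / Real.cos a ^ 2) ≤ 1 := by
  rw [mul_one_div]
  exact div_le_one_of_le₀ (cutWeight_le_cos_sq hh.le ha) (sq_nonneg _)

theorem cutRatio_abs_mul_le (hh : 0 < h) {a : ℝ} (ha : 0 ≤ Real.cos a) {K : ℝ} {g : ℝ → ℝ}
    (hK : ∀ y ∈ Icc (-(1 / h)) (1 / h), |g y| ≤ K) :
    |cutWeight h a * (1 / Real.cos a ^ 2) * g (Real.tan a)| ≤ K := by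
  have hK0 : 0 ≤ K := (abs_nonneg _).trans (hK 0 ⟨by simp; positivity, by positivity⟩)
  rcases le_total (Real.cos a) h with hc | hc
  · rw [cutWeight_of_cos_le hc]; simpa using hK0
  · rw [abs_mul, abs_of_nonneg (cutRatio_nonneg a)]
    have := mul_le_mul (cutRatio_le_one hh ha) (hK _ (abs_le.1 (abs_tan_le_of_le_cos hh hc)))
      (abs_nonneg _) zero_le_one
    linarith

theorem integrable_cutRatio_mul (hh : 0 < h) {g : ℝ → ℝ} (hg : Continuous g) :
    Integrable (fun a => cutWeight h a * (1 / Real.cos a ^ 2) * g (Real.tan a)) angleMeasure := by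
  obtain ⟨K, hK⟩ := (isCompact_Icc (a := -(1 / h)) (b := 1 / h)).exists_bound_of_continuousOn
    hg.continuousOn
  have h1 := measurable_cutRatio (h := h)
  have h2 := hg.measurable.comp measurable_real_tan
  refine Integrable.of_bound (h1.mul h2).aestronglyMeasurable K ?_
  filter_upwards [ae_mem_period] with a ha
  exact cutRatio_abs_mul_le hh (cos_nonneg_of_mem_period ha) hK

theorem cutAverage_mono (hh : 0 < h) {f g : ℝ → ℝ} (hf : Continuous f) (hg : Continuous g)
    (hfg : ∀ y ∈ Icc (-(1 / h)) (1 / h), f y ≤ g y) : cutAverage h f ≤ cutAverage h g := by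
  refine integral_mono (integrable_cutRatio_mul hh hf) (integrable_cutRatio_mul hh hg) fun a => ?_
  rcases le_total (Real.cos a) h with hc | hc
  · simp [cutWeight_of_cos_le hc]
  · exact mul_le_mul_of_nonneg_left (hfg _ (abs_le.1 (abs_tan_le_of_le_cos hh hc)))
      (cutRatio_nonneg a)

theorem cutAverage_const (c : ℝ) : cutAverage h (fun _ => c) = cutAverage h (fun _ => 1) * c := by
  simp only [cutAverage, mul_one, integral_mul_const]

theorem cutAverage_const_mul (c : ℝ) (g : ℝ → ℝ) :
    cutAverage h (fun y => c * g y) = c * cutAverage h g := by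
  rw [cutAverage, cutAverage, ← integral_const_mul]
  congr 1; ext a; ring

theorem cutAverage_add (hh : 0 < h) {f g : ℝ → ℝ} (hf : Continuous f) (hg : Continuous g) :
    cutAverage h (fun y => f y + g y) = cutAverage h f + cutAverage h g := by
  rw [cutAverage, cutAverage, cutAverage,
    ← integral_add (integrable_cutRatio_mul hh hf) (integrable_cutRatio_mul hh hg)]
  congr 1; ext a; ring

theorem cutAverage_one_le (hh : 0 < h) : cutAverage h (fun _ => 1) ≤ Real.pi := by
  rw [← integral_angleMeasure_one]
  refine integral_mono_ae (integrable_cutRatio_mul hh continuous_const) (integrable_const _) ?_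
  filter_upwards [ae_mem_period] with a ha
  rw [mul_one]
  exact cutRatio_le_one hh (cos_nonneg_of_mem_period ha)

/-- The truncated kernel carries a definite mass on `[1/2, 3/4]` and on its mirror image. -/
theorem cutAverage_ge_of_ge (hh : 0 < h) (hh4 : h ≤ 1 / 4) {g : ℝ → ℝ} (hg : Continuous g)
    (hg0 : ∀ y, 0 ≤ g y) {c : ℝ} (hc0 : 0 ≤ c)
    (hc : (∀ a ∈ Icc (1 / 2 : ℝ) (3 / 4), c ≤ g (Real.tan a)) ∨
      (∀ a ∈ Icc (-(3 / 4) : ℝ) (-(1 / 2)), c ≤ g (Real.tan a))) :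
    c / 16 ≤ cutAverage h g := by
  have hpi := Real.pi_gt_three
  have hint := integrable_cutRatio_mul hh hg
  have hlow : ∀ a : ℝ, |a| ≤ 3 / 4 → 1 / 4 ≤ cutWeight h a * (1 / Real.cos a ^ 2) := by
    intro a ha
    -- For $|a|\le3/4$ this gives $\cos a\ge1/2$, hence $\cos a-h\ge\frac12\cos a$ and density at
    -- least $1/4$. The interval has length $1/4$, whence the $1/16$.
    have h1 := Real.one_sub_sq_div_two_le_cos (x := a)
    have h2 : a ^ 2 ≤ (3 / 4) ^ 2 := by rw [← sq_abs]; exact pow_le_pow_left₀ (abs_nonneg _) ha 2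
    have h3 : 1 / 2 ≤ Real.cos a := by nlinarith
    rw [cutWeight, max_eq_left (by linarith), mul_one_div, le_div_iff₀ (by positivity)]
    nlinarith
  have key : ∀ l r : ℝ, -(3 / 4) ≤ l → r ≤ 3 / 4 → r - l = 1 / 4 →
      (∀ a ∈ Icc l r, c ≤ g (Real.tan a)) → c / 16 ≤ cutAverage h g := by
    intro l r hl hr hlr hcl
    rw [cutAverage, integral_angleMeasure]
    have hII : IntervalIntegrable
        (fun a => cutWeight h a * (1 / Real.cos a ^ 2) * g (Real.tan a)) volume
        (-(Real.pi / 2)) (Real.pi / 2) :=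
      (intervalIntegrable_iff_integrableOn_Ioc_of_le (by linarith)).2 hint
    have hsub : IntervalIntegrable
        (fun a => cutWeight h a * (1 / Real.cos a ^ 2) * g (Real.tan a)) volume l r := by
      refine hII.mono_set ?_
      rw [uIcc_of_le (by linarith), uIcc_of_le (by linarith)]
      exact Icc_subset_Icc (by linarith) (by linarith)
    refine le_trans ?_ (intervalIntegral.integral_mono_interval (c := -(Real.pi / 2))
      (d := Real.pi / 2) (by linarith) (by linarith : l ≤ r) (by linarith)
      (Eventually.of_forall fun a => mul_nonneg (cutRatio_nonneg a) (hg0 _)) hII)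
    have h1 := intervalIntegral.integral_mono_on (a := l) (b := r) (μ := volume) (by linarith)
      (intervalIntegrable_const (c := 1 / 4 * c)) hsub (fun a ha => by
        refine mul_le_mul (hlow a ?_) (hcl a ha) hc0 (cutRatio_nonneg a)
        rw [abs_le]; exact ⟨by linarith [ha.1], by linarith [ha.2]⟩)
    rw [intervalIntegral.integral_const, hlr, smul_eq_mul] at h1
    linarith
  rcases hc with hc | hc
  · exact key _ _ (by norm_num) le_rfl (by norm_num) hc
  · exact key _ _ le_rfl (by norm_num) (by norm_num) hc

/-- Differentiation of a truncated average with respect to a parameter. -/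
theorem hasDerivAt_cutAverage (hh : 0 < h) {Ψ Ψ' : ℝ → ℝ → ℝ} {s₀ δ : ℝ} (hδ : 0 < δ)
    (hd : ∀ s ∈ Icc (s₀ - δ) (s₀ + δ), ∀ y, HasDerivAt (fun s => Ψ s y) (Ψ' s y) s)
    (hΨ : ∀ s ∈ Icc (s₀ - δ) (s₀ + δ), Continuous (Ψ s))
    (hΨ' : ContinuousOn (fun q : ℝ × ℝ => Ψ' q.1 q.2) (Icc (s₀ - δ) (s₀ + δ) ×ˢ univ)) :
    HasDerivAt (fun s => cutAverage h (Ψ s)) (cutAverage h (Ψ' s₀)) s₀ := by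
  have hnhds : Icc (s₀ - δ) (s₀ + δ) ∈ 𝓝 s₀ := Icc_mem_nhds (by linarith) (by linarith)
  have hs₀ : s₀ ∈ Icc (s₀ - δ) (s₀ + δ) := ⟨by linarith, by linarith⟩
  obtain ⟨K, hK⟩ := ((isCompact_Icc (a := s₀ - δ) (b := s₀ + δ)).prod
    (isCompact_Icc (a := -(1 / h)) (b := 1 / h))).exists_bound_of_continuousOn
    (hΨ'.mono (prod_mono le_rfl (subset_univ _)))
  have hc' : Continuous (Ψ' s₀) := by
    rw [← continuousOn_univ]
    exact hΨ'.comp (f := fun y => (s₀, y)) (by fun_prop) fun y _ => ⟨hs₀, mem_univ _⟩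
  refine (hasDerivAt_integral_of_dominated_loc_of_deriv_le (bound := fun _ => K)
    (F := fun s a => cutWeight h a * (1 / Real.cos a ^ 2) * Ψ s (Real.tan a))
    (F' := fun s a => cutWeight h a * (1 / Real.cos a ^ 2) * Ψ' s (Real.tan a))
    hnhds ?_ ?_ ?_ ?_ (integrable_const _) ?_).2
  · filter_upwards [hnhds] with s hs
    exact (integrable_cutRatio_mul hh (hΨ s hs)).1
  · exact integrable_cutRatio_mul hh (hΨ s₀ hs₀)
  · exact (integrable_cutRatio_mul hh hc').1
  · filter_upwards [ae_mem_period] with a ha s hs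
    exact cutRatio_abs_mul_le hh (cos_nonneg_of_mem_period ha) fun y hy => hK (s, y) ⟨hs, hy⟩
  · exact Eventually.of_forall fun a s hs => (hd s hs _).const_mul _

end cutAverage

/-! ### The solution and the evolution of its averages -/

/-- The time derivative of `θ`. -/
noncomputable def timeDeriv (θ : ℝ → ℝ → ℝ) (t x : ℝ) : ℝ :=
  fderiv ℝ (fun p : ℝ × ℝ => θ p.1 p.2) (t, x) (1, 0)

/-- The space derivative of `θ`. -/
noncomputable def spaceDeriv (θ : ℝ → ℝ → ℝ) (t x : ℝ) : ℝ :=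
  fderiv ℝ (fun p : ℝ × ℝ => θ p.1 p.2) (t, x) (0, 1)

namespace IsGlobalC1Solution
variable {θ : ℝ → ℝ → ℝ}

theorem differentiableAt (H : IsGlobalC1Solution θ) {t : ℝ} (ht : 0 < t) (x : ℝ) :
    DifferentiableAt ℝ (fun p : ℝ × ℝ => θ p.1 p.2) (t, x) :=
  (H.contDiffOn.contDiffAt ((isOpen_Ioi.prod isOpen_univ).mem_nhds
    (show (t, x) ∈ Ioi (0 : ℝ) ×ˢ univ from ⟨ht, mem_univ _⟩))).differentiableAt one_ne_zero

theorem hasDerivAt_path (H : IsGlobalC1Solution θ) {t : ℝ} (ht : 0 < t) {ξ : ℝ → ℝ} {ξ' : ℝ}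
    (hξ : HasDerivAt ξ ξ' t) :
    HasDerivAt (fun s => θ s (ξ s)) (timeDeriv θ t (ξ t) + ξ' * spaceDeriv θ t (ξ t)) t := by
  have h1 : HasDerivAt (fun s => (s, ξ s)) ((1 : ℝ), ξ') t := (hasDerivAt_id t).prodMk hξ
  have h2 := (H.differentiableAt ht (ξ t)).hasFDerivAt.comp_hasDerivAt t h1
  refine h2.congr_deriv ?_
  have e : ((1 : ℝ), ξ') = (1, 0) + ξ' • ((0 : ℝ), (1 : ℝ)) := by simp
  rw [e, map_add, map_smul, smul_eq_mul]
  rfl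

theorem hasDerivAt_time (H : IsGlobalC1Solution θ) {t : ℝ} (ht : 0 < t) (x : ℝ) :
    HasDerivAt (fun s => θ s x) (timeDeriv θ t x) t := by
  simpa using H.hasDerivAt_path ht (hasDerivAt_const t x)

theorem hasDerivAt_space (H : IsGlobalC1Solution θ) {t : ℝ} (ht : 0 < t) (x : ℝ) :
    HasDerivAt (θ t) (spaceDeriv θ t x) x := by
  have h1 : HasDerivAt (fun y => (t, y)) ((0 : ℝ), (1 : ℝ)) x :=
    (hasDerivAt_const x t).prodMk (hasDerivAt_id x)
  exact (H.differentiableAt ht x).hasFDerivAt.comp_hasDerivAt x h1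

theorem continuousOn_timeDeriv (H : IsGlobalC1Solution θ) :
    ContinuousOn (fun q : ℝ × ℝ => timeDeriv θ q.1 q.2) (Ioi 0 ×ˢ univ) :=
  (H.contDiffOn.continuousOn_fderiv_of_isOpen (isOpen_Ioi.prod isOpen_univ) le_rfl).clm_apply
    continuousOn_const

theorem continuousOn_spaceDeriv (H : IsGlobalC1Solution θ) :
    ContinuousOn (fun q : ℝ × ℝ => spaceDeriv θ q.1 q.2) (Ioi 0 ×ˢ univ) :=
  (H.contDiffOn.continuousOn_fderiv_of_isOpen (isOpen_Ioi.prod isOpen_univ) le_rfl).clm_apply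
    continuousOn_const

theorem continuous_slice {g : ℝ → ℝ → ℝ} {s : Set ℝ}
    (hg : ContinuousOn (fun q : ℝ × ℝ => g q.1 q.2) (s ×ˢ univ)) {t : ℝ} (ht : t ∈ s) :
    Continuous (g t) := by
  rw [← continuousOn_univ]
  exact hg.comp (f := fun y => (t, y)) (by fun_prop) fun y _ => ⟨ht, mem_univ _⟩

/-- At a positive time, the time derivative vanishes where the space derivative does. -/
theorem timeDeriv_eq_zero_of_isMax (H : IsGlobalC1Solution θ) {t : ℝ} (ht : 0 < t) {x : ℝ}
    (hx : ∀ y, θ t y ≤ θ t x) : timeDeriv θ t x = 0 := by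
  obtain ⟨v, -, hv⟩ := H.equation t ht x
  have h0 := IsLocalMax.hasDerivAt_eq_zero (Eventually.of_forall hx) (H.hasDerivAt_space ht x)
  rw [(H.hasDerivAt_time ht x).deriv] at hv
  have : deriv (fun y => θ t y) x = 0 := by rw [(H.hasDerivAt_space ht x).deriv, h0]
  rw [this] at hv
  linarith

/-- The spatial supremum does not decrease in time. -/
theorem exists_lt_of_lt_initial (H : IsGlobalC1Solution θ) {T m x₀ : ℝ} (hT : 0 < T) (hm : 0 < m)
    (hx₀ : m < θ 0 x₀) : ∃ x, m < θ T x := by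
  by_contra! hle
  -- The maximum principle is run backwards in time with rate $0$. It stops at $t>0$, where
  -- derivatives exist; time $0$ is reached by continuity.
  have key : ∀ t ∈ Ioo 0 T, θ t x₀ ≤ m := by
    intro t ht
    have h1 := le_add_mul_of_deriv_le_at_max (W := fun s x => θ (T - s) x) (T := T - t) (m := m)
      (D := 0) (by linarith [ht.2]) le_rfl ?_ ?_ (by simpa using hle) ?_ x₀
    · simpa using h1
    · refine H.continuousOn.comp (f := fun q : ℝ × ℝ => (T - q.1, q.2)) (by fun_prop) ?_
      rintro ⟨s, y⟩ ⟨hs, -⟩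
      exact ⟨by simp only [mem_Ici]; linarith [hs.2, ht.1], mem_univ _⟩
    · obtain ⟨R, hR⟩ := H.vanishing T m hm
      refine ⟨R, fun s hs x hx => (le_abs_self _).trans_lt (hR (T - s) ⟨?_, ?_⟩ x hx)⟩
      · linarith [hs.2, ht.1]
      · linarith [hs.1]
    · intro s hs x hx
      have hpos : 0 < T - s := by linarith [hs.2, ht.1]
      refine ⟨0, le_rfl, ?_⟩
      have h2 := H.hasDerivAt_time hpos x
      rw [H.timeDeriv_eq_zero_of_isMax hpos hx] at h2
      have h3 : HasDerivAt (fun s => T - s) (-1) s := by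
        simpa using (hasDerivAt_id s).const_sub T
      have h4 := HasDerivAt.comp (h₂ := fun s => θ s x) s h2 h3
      rw [zero_mul] at h4
      exact h4
  have hlim : Tendsto (fun t => θ t x₀) (𝓝[>] 0) (𝓝 (θ 0 x₀)) := by
    have h1 : ContinuousWithinAt (fun t => θ t x₀) (Ici 0) 0 :=
      (H.continuousOn.comp (f := fun t : ℝ => (t, x₀)) (s := Ici 0) (by fun_prop)
        fun t ht => ⟨ht, mem_univ _⟩) 0 self_mem_Ici
    exact h1.mono_left (nhdsWithin_mono _ Ioi_subset_Ici_self)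
  have := le_of_tendsto hlim (by
    filter_upwards [Ioo_mem_nhdsGT hT] with t ht using key t ht)
  linarith

theorem exists_bound (H : IsGlobalC1Solution θ) (T : ℝ) :
    ∃ C, ∀ t ∈ Icc 0 T, ∀ x, |θ t x| ≤ C := by
  obtain ⟨R, hR⟩ := H.vanishing T 1 one_pos
  obtain ⟨K, hK⟩ := ((isCompact_Icc (a := 0) (b := T)).prod
    (isCompact_Icc (a := -R) (b := R))).exists_bound_of_continuousOn
    (H.continuousOn.mono (prod_mono Icc_subset_Ici_self (subset_univ _)))
  refine ⟨max K 1, fun t ht x => ?_⟩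
  rcases le_total R |x| with hx | hx
  · exact (hR t ht x hx).le.trans (le_max_right _ _)
  · exact (hK (t, x) ⟨ht, abs_le.1 hx⟩).trans (le_max_left _ _)

/-- Growth bound for the truncated average at a spatial maximum, along a moving scale. -/
theorem exists_hasDerivAt_cutAverage_le (H : IsGlobalC1Solution θ) {h η C t x : ℝ} (hh : 0 < h)
    (hdrift : DriftLowerBound h η) (ht : 0 < t) (hC : ∀ y, |θ t y| ≤ C) {e e' : ℝ → ℝ}
    (he : ∀ s, HasDerivAt e (e' s) s) (he' : Continuous e') (het : 0 < e t)
    (hmax : ∀ y, cutAverage h (fun u => θ t (y + e t * u)) ≤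
      cutAverage h (fun u => θ t (x + e t * u))) :
    ∃ d ≤ (4 * Real.pi * e' t ^ 2 + η * C ^ 2) / e t,
      HasDerivAt (fun s => cutAverage h (fun u => θ s (x + e s * u))) d t := by
  have hpi := Real.pi_pos
  have hec : Continuous e := continuous_iff_continuousAt.2 fun s => (he s).continuousAt
  have hθx := continuous_slice H.continuousOn_spaceDeriv (t := t) ht
  have hθt := continuous_slice H.continuousOn_timeDeriv (t := t) ht
  -- stationarity in space
  have hspace : HasDerivAt (fun y => cutAverage h (fun u => θ t (y + e t * u)))
      (cutAverage h (fun u => spaceDeriv θ t (x + e t * u))) x := by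
    refine hasDerivAt_cutAverage (Ψ := fun y u => θ t (y + e t * u))
      (Ψ' := fun y u => spaceDeriv θ t (y + e t * u)) hh one_pos ?_ ?_ ?_
    · intro y _ u
      exact (H.hasDerivAt_space ht (y + e t * u)).comp_add_const y (e t * u)
    · intro y _
      exact (continuous_slice H.continuousOn (t := t) ht.le).comp (by fun_prop)
    · exact (hθx.comp (f := fun q : ℝ × ℝ => q.1 + e t * q.2) (by fun_prop)).continuousOn
  -- Stationarity is the zero-pairing hypothesis of `DriftLowerBound`, which cancels the unknown
  -- constant in the Hilbert transform.
  have hstat := IsLocalMax.hasDerivAt_eq_zero (Eventually.of_forall hmax) hspace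
  -- derivative in time
  have htime : HasDerivAt (fun s => cutAverage h (fun u => θ s (x + e s * u)))
      (cutAverage h (fun u => timeDeriv θ t (x + e t * u)
        + e' t * u * spaceDeriv θ t (x + e t * u))) t := by
    have hpos : ∀ s ∈ Icc (t - t / 2) (t + t / 2), 0 < s := fun s hs => by linarith [hs.1]
    refine hasDerivAt_cutAverage (Ψ := fun s u => θ s (x + e s * u))
      (Ψ' := fun s u => timeDeriv θ s (x + e s * u) + e' s * u * spaceDeriv θ s (x + e s * u))
      hh (half_pos ht) ?_ ?_ ?_
    · intro s hs u
      exact H.hasDerivAt_path (hpos s hs) (((he s).mul_const u).const_add x)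
    · intro s hs
      exact (continuous_slice H.continuousOn (hpos s hs).le).comp (by fun_prop)
    · have hmap : MapsTo (fun q : ℝ × ℝ => (q.1, x + e q.1 * q.2))
          (Icc (t - t / 2) (t + t / 2) ×ˢ univ) (Ioi 0 ×ˢ univ) :=
        fun q hq => ⟨hpos _ hq.1, mem_univ _⟩
      have hc : ContinuousOn (fun q : ℝ × ℝ => (q.1, x + e q.1 * q.2))
          (Icc (t - t / 2) (t + t / 2) ×ˢ univ) := by fun_prop
      exact (H.continuousOn_timeDeriv.comp hc hmap).add
        (ContinuousOn.mul (by fun_prop) (H.continuousOn_spaceDeriv.comp hc hmap))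
  refine ⟨_, ?_, htime⟩
  choose v hv heq using fun u => H.equation t ht (x + e t * u)
  have hv' : ∀ u, timeDeriv θ t (x + e t * u) = -(v u * spaceDeriv θ t (x + e t * u)) := by
    intro u
    have h1 := heq u
    rw [(H.hasDerivAt_time ht _).deriv] at h1
    have : deriv (fun y => θ t y) (x + e t * u) = spaceDeriv θ t (x + e t * u) :=
      (H.hasDerivAt_space ht _).deriv
    rw [this] at h1
    linarith
  obtain ⟨c, hc⟩ := exists_hilbert_angle_form (fun y => H.hasDerivAt_space ht y) hθx hC het hv
  have hp : ∀ u, HasDerivAt (fun u => θ t (x + e t * u))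
      (e t * spaceDeriv θ t (x + e t * u)) u := by
    intro u
    have d : HasDerivAt (fun u => x + e t * u) (e t) u := by
      simpa using ((hasDerivAt_id u).const_mul (e t)).const_add x
    have := HasDerivAt.comp (h₂ := θ t) u (H.hasDerivAt_space ht _) d
    rw [mul_comm] at this
    exact this
  have hD := hdrift (fun u => θ t (x + e t * u)) (fun u => e t * spaceDeriv θ t (x + e t * u))
    (fun a => v (Real.tan a)) C c hp (by fun_prop) (fun u => hC _) hc (by
      have : ∀ a, cutWeight h a * (e t * spaceDeriv θ t (x + e t * Real.tan a)
          * (1 / Real.cos a ^ 2)) = e t * (cutWeight h a * (1 / Real.cos a ^ 2)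
          * spaceDeriv θ t (x + e t * Real.tan a)) := fun a => by ring
      simp_rw [this, integral_const_mul]
      exact mul_eq_zero_of_right _ hstat)
  have eL : ∫ a, cutWeight h a * (e t * spaceDeriv θ t (x + e t * Real.tan a)
      * (1 / Real.cos a ^ 2)) * Real.tan a ∂angleMeasure
      = e t * cutAverage h (fun u => u * spaceDeriv θ t (x + e t * u)) := by
    rw [cutAverage, ← integral_const_mul]
    congr 1; ext a; ring
  have eN : ∫ a, cutWeight h a * (e t * spaceDeriv θ t (x + e t * Real.tan a)
      * (1 / Real.cos a ^ 2)) * v (Real.tan a) ∂angleMeasure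
      = -(e t * cutAverage h (fun u => timeDeriv θ t (x + e t * u))) := by
    rw [cutAverage, ← integral_const_mul, ← integral_neg]
    congr 1; ext a
    rw [hv']; ring
  rw [eL, eN] at hD
  have hsplit : cutAverage h (fun u => timeDeriv θ t (x + e t * u)
        + e' t * u * spaceDeriv θ t (x + e t * u))
      = cutAverage h (fun u => timeDeriv θ t (x + e t * u))
        + e' t * cutAverage h (fun u => u * spaceDeriv θ t (x + e t * u)) := by
    rw [← cutAverage_const_mul, ← cutAverage_add hh (by fun_prop) (by fun_prop)]
    congr 1; ext u; ring
  rw [hsplit, le_div_iff₀ het]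
  set A := cutAverage h (fun u => timeDeriv θ t (x + e t * u))
  set L := cutAverage h (fun u => u * spaceDeriv θ t (x + e t * u))
  -- Completing the square: the coercive term from the drift absorbs the dilation term.
  have hsq : e' t * L * e t ≤ 1 / (16 * Real.pi) * (e t * L) ^ 2 + 4 * Real.pi * e' t ^ 2 := by
    have h1 : 1 / (16 * Real.pi) * (e t * L) ^ 2 + 4 * Real.pi * e' t ^ 2 - e' t * L * e t
        = 1 / (16 * Real.pi) * (e t * L - 8 * Real.pi * e' t) ^ 2 := by
      field_simp; ring
    have h2 : 0 ≤ 1 / (16 * Real.pi) * (e t * L - 8 * Real.pi * e' t) ^ 2 := by positivity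
    linarith
  linarith

end IsGlobalC1Solution

/-! ### Shrinking the scale to a contradiction -/

namespace IsGlobalC1Solution
variable {θ : ℝ → ℝ → ℝ}

theorem continuousOn_cutAverage (H : IsGlobalC1Solution θ) {h T C : ℝ} (hh : 0 < h)
    (hC : ∀ t ∈ Icc 0 T, ∀ x, |θ t x| ≤ C) {e : ℝ → ℝ} (he : Continuous e) :
    ContinuousOn (fun q : ℝ × ℝ => cutAverage h (fun u => θ q.1 (q.2 + e q.1 * u)))
      (Icc 0 T ×ˢ univ) := by
  refine continuousOn_of_dominated (bound := fun _ => C) ?_ ?_ (integrable_const _) ?_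
  · intro q hq
    have : Continuous fun u => θ q.1 (q.2 + e q.1 * u) :=
      (continuous_slice H.continuousOn (t := q.1) hq.1.1).comp (by fun_prop)
    exact (integrable_cutRatio_mul hh this).1
  · intro q hq
    filter_upwards [ae_mem_period] with a ha
    exact cutRatio_abs_mul_le (g := fun u => θ q.1 (q.2 + e q.1 * u)) hh
      (cos_nonneg_of_mem_period ha) fun y _ => hC q.1 hq.1 _
  · refine Eventually.of_forall fun a => ?_
    refine continuousOn_const.mul (H.continuousOn.comp
      (f := fun q : ℝ × ℝ => (q.1, q.2 + e q.1 * Real.tan a)) (by fun_prop) ?_)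
    exact fun q hq => ⟨hq.1.1, mem_univ _⟩

/-- The truncation confines $u$ to $|u|\le1/h$, so far-away averages only see points where $\theta$
is small; as the total mass is at most $\pi$, the average is at most $m/2$. -/
theorem exists_cutAverage_lt (H : IsGlobalC1Solution θ) {h T m E : ℝ} (hh : 0 < h) (hm : 0 < m)
    {e : ℝ → ℝ} (hE : ∀ t ∈ Icc 0 T, |e t| ≤ E) :
    ∃ R, ∀ t ∈ Icc 0 T, ∀ x, R ≤ |x| → cutAverage h (fun u => θ t (x + e t * u)) < m := by
  have hpi := Real.pi_pos
  obtain ⟨R, hR⟩ := H.vanishing T (m / (2 * Real.pi)) (by positivity)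
  refine ⟨R + E * (1 / h), fun t ht x hx => ?_⟩
  have h1 := cutAverage_mono hh (f := fun u => θ t (x + e t * u)) (g := fun _ => m / (2 * Real.pi))
    ((continuous_slice H.continuousOn (t := t) ht.1).comp (by fun_prop)) continuous_const
    (fun y hy => by
      have h2 : |e t * y| ≤ E * (1 / h) := by
        rw [abs_mul]
        exact mul_le_mul (hE t ht) (abs_le.2 hy) (abs_nonneg _) ((abs_nonneg _).trans (hE t ht))
      have h3 : |x| ≤ |x + e t * y| + |e t * y| := by
        simpa using abs_sub (x + e t * y) (e t * y)
      exact (le_abs_self _).trans (hR t ht _ (by linarith)).le)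
  rw [cutAverage_const] at h1
  have h4 := mul_le_mul_of_nonneg_right (cutAverage_one_le hh)
    (by positivity : 0 ≤ m / (2 * Real.pi))
  have h5 : Real.pi * (m / (2 * Real.pi)) = m / 2 := by field_simp
  linarith

/-- Truncated averages over a small scale are close to point values, uniformly in the truncation. -/
theorem cutAverage_ge_of_modulus {h ρ δ ε σ C x : ℝ} (hh : 0 < h) (hρ : 0 < ρ) (hε : 0 < ε)
    (hερ : ε * (1 / ρ) < δ) {g : ℝ → ℝ} (hg : Continuous g) (hC : ∀ y, |g y| ≤ C)
    (hmod : ∀ y, |y - x| < δ → g x - σ ≤ g y) (hσ : 0 ≤ σ) :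
    cutAverage h (fun _ => 1) * (g x - σ) - 4 * C * kernelDeficit ρ
      ≤ cutAverage h (fun u => g (x + ε * u)) := by
  have hC0 : 0 ≤ C := (abs_nonneg _).trans (hC 0)
  have v1 := (integrable_cutRatio_mul hh (continuous_const (y := g x - σ))).hasIntegralValue
  have v2 : HasIntegralValue angleMeasure (fun a => ρ ^ 2 / (Real.cos a ^ 2 + ρ ^ 2))
      (kernelDeficit ρ) := by
    refine ⟨Measurable.integrable_of_abs_le (by fun_prop) 1 fun a => ?_, integral_deficit_cos⟩
    rw [abs_of_nonneg (deficit_nonneg _)]; exact deficit_le_one _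
  have v3 := (integrable_cutRatio_mul hh
    (hg.comp (by fun_prop : Continuous fun u => x + ε * u))).hasIntegralValue
  have v4 := v1.sub (v2.const_mul (4 * C))
  have hle := integral_mono_ae v4.1 v3.1 (by
    filter_upwards [ae_mem_period] with a ha
    have hca := cos_nonneg_of_mem_period ha
    have r0 := cutRatio_nonneg (h := h) a
    have r1 := cutRatio_le_one hh hca
    set r := cutWeight h a * (1 / Real.cos a ^ 2)
    simp only [Function.comp_apply]
    have hq0 := deficit_nonneg (μ := ρ) (Real.cos a)
    -- Angles with $\cos a\ge\rho$ stay within $\delta$ of $x$. The others lose at most $2C$, paid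
    -- for by the deficit, which is at least $1/2$ there; hence the bound does not depend on $h$.
    rcases le_total ρ (Real.cos a) with hc | hc
    · have h1 : |x + ε * Real.tan a - x| < δ := by
        rw [add_sub_cancel_left, abs_mul, abs_of_pos hε]
        exact (mul_le_mul_of_nonneg_left (abs_tan_le_of_le_cos hρ hc) hε.le).trans_lt hερ
      have h2 := mul_le_mul_of_nonneg_left (hmod _ h1) r0
      have h3 : 0 ≤ 4 * C * (ρ ^ 2 / (Real.cos a ^ 2 + ρ ^ 2)) := by positivity
      linarith
    · have h1 : 1 / 2 ≤ ρ ^ 2 / (Real.cos a ^ 2 + ρ ^ 2) := by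
        rw [div_le_div_iff₀ (by norm_num) (by positivity)]
        nlinarith
      have h2 := mul_le_mul_of_nonneg_left h1 (by positivity : 0 ≤ 4 * C)
      have h3 : g x - σ - g (x + ε * Real.tan a) ≤ 2 * C := by
        linarith [(abs_le.1 (hC x)).2, (abs_le.1 (hC (x + ε * Real.tan a))).1]
      have h4 := mul_le_mul_of_nonneg_left h3 r0
      have h5 : r * (2 * C) ≤ 1 * (2 * C) := mul_le_mul_of_nonneg_right r1 (by positivity)
      linarith)
  rw [v4.2, v3.2] at hle
  have e1 : ∫ a, cutWeight h a * (1 / Real.cos a ^ 2) * (g x - σ) ∂angleMeasure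
      = cutAverage h (fun _ => 1) * (g x - σ) := cutAverage_const _
  rw [e1] at hle
  exact hle

/-- A definite gap between the maximum and the initial averages at a large scale. -/
theorem exists_initial_gap (H : IsGlobalC1Solution θ) {M : ℝ} (hM : 0 < M)
    (hmax : ∀ x, θ 0 x ≤ M) : ∃ e₀ > 0, ∀ h, 0 < h → h ≤ 1 / 4 → ∀ x,
      cutAverage h (fun u => θ 0 (x + e₀ * u)) ≤ cutAverage h (fun _ => 1) * M - M / 32 := by
  obtain ⟨R, hR⟩ := H.vanishing 0 (M / 2) (by positivity)
  have hR' : ∀ x, max R 1 ≤ |x| → θ 0 x ≤ M / 2 := fun x hx =>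
    (le_abs_self _).trans (hR 0 ⟨le_rfl, le_rfl⟩ x ((le_max_left _ _).trans hx)).le
  set R' := max R 1
  have hR'1 : 1 ≤ R' := le_max_right _ _
  -- At this scale $\tan a\ge1/2$ moves a point by at least $R'$. Moving away from the origin, on
  -- the side of the sign of $x$, lands where $\theta_0\le M/2$; the mass $1/16$ times the loss
  -- $M/2$ gives $M/32$.
  refine ⟨2 * R', by positivity, fun h hh hh4 x => ?_⟩
  have hc : Continuous fun u => θ 0 (x + 2 * R' * u) :=
    (continuous_slice H.continuousOn (t := 0) self_mem_Ici).comp (by fun_prop)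
  have htan : ∀ a ∈ Icc (1 / 2 : ℝ) (3 / 4), 1 / 2 ≤ Real.tan a := fun a ha =>
    ha.1.trans (Real.le_tan (by linarith [ha.1]) (by linarith [ha.2, Real.pi_gt_three]))
  have hgap := cutAverage_ge_of_ge hh hh4 (g := fun u => M - θ 0 (x + 2 * R' * u))
    (continuous_const.sub hc) (fun u => by linarith [hmax (x + 2 * R' * u)]) (c := M / 2)
    (by positivity) (by
      rcases le_total 0 x with hx | hx
      · left
        intro a ha
        have h1 := htan a ha
        have h2 := hR' (x + 2 * R' * Real.tan a) (by
          refine le_trans ?_ (le_abs_self _)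
          nlinarith)
        linarith
      · right
        intro a ha
        have h1 := htan (-a) ⟨by linarith [ha.2], by linarith [ha.1]⟩
        rw [Real.tan_neg] at h1
        have h2 := hR' (x + 2 * R' * Real.tan a) (by
          refine le_trans ?_ (neg_le_abs _)
          nlinarith)
        linarith)
  have e1 : cutAverage h (fun _ => M) = cutAverage h (fun u => M - θ 0 (x + 2 * R' * u))
      + cutAverage h (fun u => θ 0 (x + 2 * R' * u)) := by
    have hc' : Continuous fun u => M - θ 0 (x + 2 * R' * u) := continuous_const.sub hc
    rw [← cutAverage_add hh hc' hc]
    congr 1; ext u; ring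
  rw [cutAverage_const] at e1
  linarith

/-- A global solution cannot have a positive initial maximum. -/
theorem false_of_pos_max (H : IsGlobalC1Solution θ) {M x₀ : ℝ} (hM : 0 < M)
    (hx₀ : θ 0 x₀ = M) (hmax : ∀ x, θ 0 x ≤ M) : False := by
  have hpi := Real.pi_pos
  have hpi4 := Real.pi_lt_four
  obtain ⟨e₀, he₀, hgap⟩ := H.exists_initial_gap hM hmax
  -- the final time, the bound, the final scale, and the truncation
  set T := 16 * Real.pi * e₀ * 256 / M with hTdef
  have hT : 0 < T := by positivity
  obtain ⟨C, hC⟩ := H.exists_bound T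
  have hMC : M ≤ C := by
    have := hC 0 ⟨le_rfl, hT.le⟩ x₀
    rw [hx₀, abs_of_pos hM] at this
    exact this
  have hCpos : 0 < C := hM.trans_le hMC
  obtain ⟨ρ, hρe, hρ⟩ : ∃ ρ : ℝ, 4 * C * kernelDeficit ρ < M / 256 ∧ 0 < ρ := by
    have t1 : Tendsto (fun ρ => 4 * C * kernelDeficit ρ) (𝓝[>] 0) (𝓝 0) := by
      simpa using tendsto_kernelDeficit.const_mul (4 * C)
    exact ((t1.eventually (gt_mem_nhds (by positivity : 0 < M / 256))).and
      self_mem_nhdsWithin).exists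
  obtain ⟨R, hR⟩ := H.vanishing T (M / 2) (by positivity)
  have huc := ((isCompact_Icc (a := 0) (b := T)).prod
    (isCompact_Icc (a := -(R + 1)) (b := R + 1))).uniformContinuousOn_of_continuous
    (H.continuousOn.mono (prod_mono Icc_subset_Ici_self (subset_univ _)))
  obtain ⟨δ, hδ, hunif⟩ := Metric.uniformContinuousOn_iff.1 huc (M / 2000) (by positivity)
  obtain ⟨r, ⟨hr1, hrδ⟩, hr⟩ : ∃ r : ℝ, (r < 1 ∧ e₀ * r ^ 2 * (1 / ρ) < min δ 1) ∧ 0 < r := by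
    have t1 : Tendsto (fun r : ℝ => r) (𝓝[>] 0) (𝓝 0) := tendsto_id.mono_left nhdsWithin_le_nhds
    have t2 : Tendsto (fun r : ℝ => e₀ * r ^ 2 * (1 / ρ)) (𝓝[>] 0) (𝓝 0) := by
      have : Continuous fun r : ℝ => e₀ * r ^ 2 * (1 / ρ) := by fun_prop
      simpa using (this.tendsto 0).mono_left (nhdsWithin_le_nhds (s := Ioi 0))
    exact (((t1.eventually (gt_mem_nhds one_pos)).and
      (t2.eventually (gt_mem_nhds (lt_min hδ one_pos)))).and self_mem_nhdsWithin).exists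
  have hr : 0 < r := hr
  -- Makes the truncation cost rate $\eta C^2/e$ at most $M/(256T)$ down to the final scale
  -- $e_0r^2$. The truncation $h$ can come last because the initial gap and the final comparison are
  -- uniform in it.
  set η := M * (e₀ * r ^ 2) / (256 * C ^ 2 * T) with hηdef
  have hη : 0 < η := by positivity
  obtain ⟨h, hh, hh4, hdrift⟩ := exists_driftLowerBound hη
  -- the shrinking scale
  set e : ℝ → ℝ := fun t => e₀ * (1 - t / T) ^ 2 with hedef
  set e' : ℝ → ℝ := fun t => -(2 * e₀ * (1 - t / T) / T) with hedef'
  have he : ∀ s, HasDerivAt e (e' s) s := by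
    intro s
    have h1 : HasDerivAt (fun s => 1 - s / T) (-(1 / T)) s :=
      ((hasDerivAt_id s).div_const T).const_sub 1
    refine ((h1.pow 2).const_mul e₀).congr_deriv ?_
    simp only [hedef']
    push_cast
    ring
  have hec : Continuous e := by fun_prop
  have he'c : Continuous e' := by fun_prop
  set T₁ := T * (1 - r) with hT₁
  have hT₁pos : 0 < T₁ := mul_pos hT (by linarith)
  have hT₁T : T₁ ≤ T := by nlinarith
  have hfrac : ∀ t ∈ Icc 0 T₁, r ≤ 1 - t / T ∧ 1 - t / T ≤ 1 := by
    intro t ht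
    have h1 : t / T ≤ 1 - r := by
      rw [div_le_iff₀ hT]; linarith [ht.2]
    have h2 : 0 ≤ t / T := div_nonneg ht.1 hT.le
    constructor <;> linarith
  have heT₁ : e T₁ = e₀ * r ^ 2 := by
    simp only [hedef, hT₁]
    field_simp
    ring
  have he0 : e 0 = e₀ := by simp [hedef]
  have helow : ∀ t ∈ Icc 0 T₁, e₀ * r ^ 2 ≤ e t := fun t ht =>
    mul_le_mul_of_nonneg_left (pow_le_pow_left₀ hr.le (hfrac t ht).1 2) he₀.le
  set μ₀ := cutAverage h (fun _ => 1) with hμ₀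
  have hμ₀low : 1 / 16 ≤ μ₀ :=
    cutAverage_ge_of_ge hh hh4 continuous_const (fun _ => zero_le_one) zero_le_one
      (Or.inl fun _ _ => le_rfl)
  have hμ₀pi : μ₀ ≤ Real.pi := cutAverage_one_le hh
  have hgrow := le_add_mul_of_deriv_le_at_max (T := T₁)
    (W := fun t x => cutAverage h (fun u => θ t (x + e t * u))) (m := μ₀ * M - M / 32)
    (D := M / (256 * T) + M / (256 * T)) hT₁pos (by positivity)
    (H.continuousOn_cutAverage hh (fun t ht => hC t ⟨ht.1, ht.2.trans hT₁T⟩) hec)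
    (H.exists_cutAverage_lt hh (by nlinarith) (E := e₀) (fun t ht => by
      have h1 := hfrac t ht
      simp only [hedef]
      rw [abs_of_nonneg (by positivity)]
      have : (1 - t / T) ^ 2 ≤ 1 := pow_le_one₀ (hr.le.trans h1.1) h1.2
      nlinarith))
    (fun x => by rw [he0]; exact hgap h hh hh4 x)
    (fun t ht x hx => by
      have ht' : t ∈ Icc 0 T₁ := ⟨ht.1.le, ht.2⟩
      have hle := helow t ht'
      have hetpos : 0 < e t := (by positivity : 0 < e₀ * r ^ 2).trans_le hle
      obtain ⟨d, hd, hder⟩ := H.exists_hasDerivAt_cutAverage_le hh hdrift ht.1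
        (hC t ⟨ht'.1, ht'.2.trans hT₁T⟩) he he'c hetpos hx
      refine ⟨d, hd.trans ?_, hder⟩
      rw [add_div]
      refine add_le_add (le_of_eq ?_) ?_
      · have h1 : 1 - t / T ≠ 0 := (hr.trans_le (hfrac t ht').1).ne'
        have h2 : 4 * Real.pi * e' t ^ 2 / e t = 16 * Real.pi * e₀ / T ^ 2 := by
          simp only [hedef, hedef']
          generalize 1 - t / T = q at h1
          field_simp
          ring
        rw [h2, div_eq_div_iff (by positivity) (by positivity)]
        have h3 : T * M = 16 * Real.pi * e₀ * 256 := by rw [hTdef]; field_simp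
        linear_combination -T * h3
      · calc η * C ^ 2 / e t ≤ η * C ^ 2 / (e₀ * r ^ 2) := by gcongr
          _ = M / (256 * T) := by rw [hηdef]; field_simp)
  -- the final average is close to the maximum
  obtain ⟨x₁, hx₁⟩ := H.exists_lt_of_lt_initial (m := M - M / 2000) (x₀ := x₀) hT₁pos
    (by linarith) (by rw [hx₀]; linarith)
  have hT₁mem : T₁ ∈ Icc 0 T := ⟨hT₁pos.le, hT₁T⟩
  have hx₁R : |x₁| < R := by
    by_contra! hle
    have := (le_abs_self _).trans_lt (hR T₁ hT₁mem x₁ hle)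
    linarith
  have hx₁R' := abs_lt.1 hx₁R
  have hend := cutAverage_ge_of_modulus (h := h) (ε := e₀ * r ^ 2) (δ := min δ 1) (x := x₁)
    (σ := M / 2000) hh hρ (by positivity) hrδ
    (continuous_slice H.continuousOn (t := T₁) hT₁pos.le) (hC T₁ hT₁mem) (fun y hy => by
      have hy1 := abs_lt.1 (hy.trans_le (min_le_right _ _))
      have hd := hunif (T₁, y) ⟨hT₁mem, by constructor <;> linarith⟩ (T₁, x₁)
        ⟨hT₁mem, by constructor <;> linarith⟩ (by
          rw [Prod.dist_eq, dist_self, Real.dist_eq]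
          exact max_lt hδ (hy.trans_le (min_le_left _ _)))
      rw [Real.dist_eq] at hd
      linarith [(abs_lt.1 hd).1]) (by positivity)
  -- Together the estimates would give $M/32<M/128+M/256+4M/1000$, which is false for $M>0$.
  have hfin := hgrow x₁
  rw [heT₁] at hfin
  have hDT : (M / (256 * T) + M / (256 * T)) * T₁ ≤ M / 128 := by
    calc _ ≤ (M / (256 * T) + M / (256 * T)) * T := by gcongr
      _ = M / 128 := by field_simp; norm_num
  have hμx : μ₀ * (M - M / 1000) ≤ μ₀ * (θ T₁ x₁ - M / 2000) :=
    mul_le_mul_of_nonneg_left (by linarith) (by linarith)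
  have hμM : μ₀ * (M / 1000) ≤ 4 * (M / 1000) :=
    mul_le_mul_of_nonneg_right (by linarith) (by positivity)
  linarith

end IsGlobalC1Solution

theorem theorem3p4 (θ₀ : ℝ → ℝ)
    (htop : Tendsto θ₀ atTop (𝓝 0)) (hbot : Tendsto θ₀ atBot (𝓝 0))
    (x₀ : ℝ) (hpos : 0 < θ₀ x₀) (hmax : ∀ x : ℝ, θ₀ x ≤ θ₀ x₀) :
    ¬ ∃ θ : ℝ → ℝ → ℝ, IsGlobalC1Solution θ ∧ ∀ x : ℝ, θ 0 x = θ₀ x := by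
  rintro ⟨θ, H, hθ⟩
  exact H.false_of_pos_max hpos (hθ x₀) fun x => by rw [hθ]; exact hmax x
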